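/- A labelled poset $(P,\omega)$ is a finite poset $P$ with an injective map $\omega:P\to\mathbb{N}$. For $k\ge 0$ let $e_k(P,\omega)$ be the number of surjective maps $\sigma:P\to[k]=\{1,\dots,k\}$ such that $\sigma(x)\ge\sigma(y)$ whenever $x\le y$, and $\sigma(x)>\sigma(y)$ whenever $x<y$ and $\omega(x)>\omega(y)$. Let $$E(P,\omega)=\sum_{k=0}^{|P|}e_k(P,\omega)\,t^k\in\mathbb{R}[t]$$ (so $E=1$ for the empty poset, while $e_0(P,\omega)=0$ if $P\ne\emptyset$). The series-parallel labelled posets form the smallest class of labelled posets, closed under isomorphism, that contains the empty and the one-element labelled posets and such that, whenever $(P,\omega)$ and $(Q,\nu)$ belong to it, so does $(S,\mu)$ in each of the following cases, where $\mu$ is a labelling of $S$ with $\mu(x)<\mu(y)$ whenever $x,y\in P$ and $\omega(x)<\omega(y)$, or $x,y\in Q$ and $\nu(x)<\nu(y)$: (a) $S=P\oplus Q$ is the ordinal sum (every element of $P$ lies below every element of $Q$) and $\mu(x)<\mu(y)$ for all $x\in P$, $y\in Q$; (b) $S=P\oplus Q$ is the ordinal sum and $\mu(x)>\mu(y)$ for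 all $x\in P$, $y\in Q$; (c) $S=P\sqcup Q$ is the disjoint union (elements of $P$ and of $Q$ are incomparable). For nonzero $f,g\in\mathbb{R}[t]$ with only real zeros, $g$ interlaces $f$, written $g\preceq f$, if $\deg f=\deg g+1=d$ and $$\alpha_1\le\beta_1\le\alpha_2\le\cdots\le\beta_{d-1}\le\alpha_d,$$ where $\alpha_1\le\cdots\le\alpha_d$ and $\beta_1\le\cdots\le\beta_{d-1}$ are the zeros of $f$ and $g$, with multiplicity. **Corollary.** If $(S,\mu)$ is a series-parallel labelled poset and $x\in S$, then $$E(S\setminus x,\mu)\preceq E(S,\mu),$$ where $S\setminus x=S\setminus\{x\}$ carries the induced order and the restriction of $\mu$. In particular, both polynomials have only real zeros. -/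

import Mathlib

open Polynomial

namespace LabelledPoset

universe u

/-- `σ : P → [k]` is a `(P, ω)`-partition with largest part at most `k`, the chain `[k]` being
modelled by `Fin k`. The labelling `ω` is an injective map `P → ℕ`. -/
structure IsPartition {P : Type*} [PartialOrder P] (ω : P ↪ ℕ) {k : ℕ} (σ : P → Fin k) : Prop where
  le_of_le : ∀ x y : P, x ≤ y → σ y ≤ σ x
  lt_of_lt : ∀ x y : P, x < y → ω y < ω x → σ y < σ x

/-- `e_k(P, ω)`: the number of surjective `(P, ω)`-partitions `P → [k]`. -/
noncomputable def surjCount {P : Type*} [PartialOrder P] (ω : P ↪ ℕ) (k : ℕ) : ℕ :=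
  Nat.card {σ : P → Fin k // IsPartition ω σ ∧ Function.Surjective σ}

/-- The `E`-polynomial of a finite labelled poset. The term `k = 0` is zero unless `P` is empty,
and gives the empty poset the polynomial `1`. -/
noncomputable def ePoly {P : Type*} [PartialOrder P] (ω : P ↪ ℕ) : ℝ[X] :=
  ∑ k ∈ Finset.range (Nat.card P + 1), C (surjCount ω k : ℝ) * X ^ k

/-- The labelling of `P ∖ x` obtained by restricting `ω`. -/
def deleteLabel {P : Type*} (ω : P ↪ ℕ) (x : P) : {y : P // y ≠ x} ↪ ℕ :=
  (Function.Embedding.subtype fun y : P => y ≠ x).trans ω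

/-- `μ` is a labelling `ω ⊕₀ ν` of the ordinal sum (`P` below `Q`): it is compatible with `ω` and
with `ν`, and the labels on `P` are smaller than those on `Q`. -/
structure IsOrdinalSumLabel₀ {P Q : Type*} (ω : P ↪ ℕ) (ν : Q ↪ ℕ) (μ : P ⊕ₗ Q ↪ ℕ) : Prop where
  left : ∀ x y : P, ω x < ω y → μ (Sum.inlₗ x) < μ (Sum.inlₗ y)
  right : ∀ x y : Q, ν x < ν y → μ (Sum.inrₗ x) < μ (Sum.inrₗ y)
  cross : ∀ (x : P) (y : Q), μ (Sum.inlₗ x) < μ (Sum.inrₗ y)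

/-- `μ` is a labelling `ω ⊕₁ ν` of the ordinal sum (`P` below `Q`): it is compatible with `ω` and
with `ν`, and the labels on `Q` are smaller than those on `P`. -/
structure IsOrdinalSumLabel₁ {P Q : Type*} (ω : P ↪ ℕ) (ν : Q ↪ ℕ) (μ : P ⊕ₗ Q ↪ ℕ) : Prop where
  left : ∀ x y : P, ω x < ω y → μ (Sum.inlₗ x) < μ (Sum.inlₗ y)
  right : ∀ x y : Q, ν x < ν y → μ (Sum.inrₗ x) < μ (Sum.inrₗ y)
  cross : ∀ (x : Q) (y : P), μ (Sum.inrₗ x) < μ (Sum.inlₗ y)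

/-- `μ` is a labelling `ω ⊔ ν` of the disjoint union. -/
structure IsDisjointUnionLabel {P Q : Type*} (ω : P ↪ ℕ) (ν : Q ↪ ℕ) (μ : P ⊕ Q ↪ ℕ) : Prop where
  left : ∀ x y : P, ω x < ω y → μ (Sum.inl x) < μ (Sum.inl y)
  right : ∀ x y : Q, ν x < ν y → μ (Sum.inr x) < μ (Sum.inr y)

/-- Series-parallel labelled posets, up to isomorphism. In Mathlib the order on `P ⊕ₗ Q` is that of
the ordinal sum and the order on `P ⊕ Q` is that of the disjoint union. -/
inductive IsSeriesParallel : ∀ {S : Type u} [PartialOrder S], (S ↪ ℕ) → Prop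
  | empty {S : Type u} [PartialOrder S] [IsEmpty S] (μ : S ↪ ℕ) : IsSeriesParallel μ
  | singleton {S : Type u} [PartialOrder S] [Unique S] (μ : S ↪ ℕ) : IsSeriesParallel μ
  | ordinalSum₀ {P Q S : Type u} [PartialOrder P] [PartialOrder Q] [PartialOrder S]
      {ω : P ↪ ℕ} {ν : Q ↪ ℕ} {μ : S ↪ ℕ} (hω : IsSeriesParallel ω) (hν : IsSeriesParallel ν)
      (e : P ⊕ₗ Q ≃o S) (h : IsOrdinalSumLabel₀ ω ν (e.toEquiv.toEmbedding.trans μ)) :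
      IsSeriesParallel μ
  | ordinalSum₁ {P Q S : Type u} [PartialOrder P] [PartialOrder Q] [PartialOrder S]
      {ω : P ↪ ℕ} {ν : Q ↪ ℕ} {μ : S ↪ ℕ} (hω : IsSeriesParallel ω) (hν : IsSeriesParallel ν)
      (e : P ⊕ₗ Q ≃o S) (h : IsOrdinalSumLabel₁ ω ν (e.toEquiv.toEmbedding.trans μ)) :
      IsSeriesParallel μ
  | disjointUnion {P Q S : Type u} [PartialOrder P] [PartialOrder Q] [PartialOrder S]
      {ω : P ↪ ℕ} {ν : Q ↪ ℕ} {μ : S ↪ ℕ} (hω : IsSeriesParallel ω) (hν : IsSeriesParallel ν)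
      (e : P ⊕ Q ≃o S) (h : IsDisjointUnionLabel ω ν (e.toEquiv.toEmbedding.trans μ)) :
      IsSeriesParallel μ

/-- `g` interlaces `f`: both are nonzero and real-rooted, `deg f = deg g + 1`, and the zeros
`α` of `f` and `β` of `g`, listed in weakly increasing order with multiplicity, satisfy
`α₀ ≤ β₀ ≤ α₁ ≤ ⋯ ≤ β_{d-1} ≤ α_d`. -/
def Interlaces (g f : ℝ[X]) : Prop :=
  g ≠ 0 ∧ f ≠ 0 ∧ g.Splits ∧ f.Splits ∧ f.natDegree = g.natDegree + 1 ∧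
    ∃ (α : Fin (g.natDegree + 1) → ℝ) (β : Fin g.natDegree → ℝ),
      Monotone α ∧ Monotone β ∧
      f.roots = Finset.univ.val.map α ∧ g.roots = Finset.univ.val.map β ∧
      ∀ i : Fin g.natDegree, α i.castSucc ≤ β i ∧ β i ≤ α i.succ

end LabelledPoset

open scoped LaurentPolynomial

namespace LabelledPoset

universe u

/-! The induction over the construction of `S` carries a stronger statement: all zeros of E(S) lie
in [-1, 0], and E(S)/E(S∖x) maps the open upper half-plane into its closure (`Proper`). With deg
E(S) = |S|, properness implies interlacing (`Proper.interlaces`).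

The number of partitions with values in an n-element chain is Σ e_k choose(n, k). An ordinal sum
with labels decreasing from P to Q multiplies the E-polynomials; with increasing labels and P, Q
nonempty it gives X E(S) = (X + 1) E(P) E(Q). Common factors do not affect properness, so these
cases are short. A disjoint union multiplies the counting functions, so E(S) = E(P) ◇ E(Q) for a
bilinear product ◇ (`diamond`), and the heart of the matter is that ◇ preserves zeros in [-1, 0] and
properness.

The key is that (f ◇ g)(t) is the constant coefficient in y of f(t + y) g(t + t(t + 1)/y)
(`aeval_diamond`). If f and g have their zeros in [-1, 0] and t is real outside [-1, 0] or Im t > 0,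
the nonzero zeros in y lie in an open half-plane bounded by a line through 0. By Gauss–Lucas the
coefficients in the relevant range are nonzero and quotients of consecutive ones lie in a half-plane
(`coeff_ne_zero_and_re_div_pos`). Nonvanishing locates the zeros of f ◇ g; the quotients show that q
◇ h is proper with respect to ((X - α)q) ◇ h. Partial fractions write any g proper with respect to f
as a nonnegative combination of polynomials obtained from f by deleting one zero, so bilinearity
gives the general case (`Proper.diamond`). -/

/-! ### Coefficients of polynomials with zeros in a half-plane, and a splitting criterion -/

/-- Gauss–Lucas for an open half-plane through the origin. -/
theorem re_mul_neg_of_isRoot_derivative {p : ℂ[X]} {u : ℂ} (hd : 0 < p.natDegree)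
    (hp : ∀ r, p.IsRoot r → (u * r).re < 0) (r : ℂ) (hr : (derivative p).IsRoot r) :
    (u * r).re < 0 := by
  have hd' : 0 < p.degree := natDegree_pos_iff_degree_pos.mp hd
  have h0 : derivative p ≠ 0 := by
    intro h
    have := derivative_eq_zero.mp h
    omega
  have hmem : r ∈ (derivative p).rootSet ℂ := by
    rw [mem_rootSet]
    exact ⟨h0, by simpa using hr⟩
  have hconv : Convex ℝ {z : ℂ | (u * z).re < 0} :=
    (convex_Iio (0 : ℝ)).is_linear_preimage (f := fun z : ℂ => (u * z).re)
      ⟨fun x y => by simp [mul_add], fun c x => by simp; ring⟩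
  have hsub : p.rootSet ℂ ⊆ {z : ℂ | (u * z).re < 0} := by
    intro z hz
    rw [mem_rootSet] at hz
    exact hp z (by simpa using hz.2)
  exact convexHull_min hsub hconv (rootSet_derivative_subset_convexHull_rootSet hd' hmem)

/-- For k = 0 the quotient is the logarithmic derivative at 0 divided by u, a sum of terms -1/(uz)
over the zeros z, each with positive real part. The hypothesis passes to the derivative by
Gauss–Lucas, and differentiation shifts coefficients up to positive factors. -/
theorem coeff_ne_zero_and_re_div_pos {u : ℂ} (k : ℕ) : ∀ {p : ℂ[X]}, p ≠ 0 →
    (∀ r, p.IsRoot r → (u * r).re < 0) →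
    (k ≤ p.natDegree → p.coeff k ≠ 0) ∧
    (k < p.natDegree → 0 < (p.coeff (k + 1) / (u * p.coeff k)).re) := by
  induction k with
  | zero =>
    intro p h0 hp
    have hev : p.eval 0 ≠ 0 := by
      intro h
      simpa using hp 0 h
    have hc : p.coeff 0 ≠ 0 := by rwa [coeff_zero_eq_eval_zero]
    refine ⟨fun _ => hc, fun hd => ?_⟩
    have h1 := (IsAlgClosed.splits p).eval_derivative_div_eval_of_ne_zero hev
    rw [← coeff_zero_eq_eval_zero, ← coeff_zero_eq_eval_zero, coeff_derivative] at h1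
    have h2 : p.coeff (0 + 1) / (u * p.coeff 0) = (p.roots.map fun z => (-(u * z))⁻¹).sum := by
      rw [mul_comm, ← div_div]
      have : p.coeff (0 + 1) / p.coeff 0 = (p.roots.map fun z => 1 / (0 - z)).sum := by
        simpa using h1
      rw [this, div_eq_mul_inv, ← Multiset.sum_map_mul_right]
      refine congrArg _ (Multiset.map_congr rfl fun z _ => ?_)
      rw [one_div, ← mul_inv]
      congr 1
      ring
    have h3 : ∀ z ∈ p.roots, 0 < ((-(u * z))⁻¹).re := by
      intro z hz
      have hz' := hp z (isRoot_of_mem_roots hz)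
      rw [Complex.inv_re]
      refine div_pos (by simpa using hz') (Complex.normSq_pos.mpr ?_)
      intro h
      rw [neg_eq_zero] at h
      simp [h] at hz'
    have hne : p.roots ≠ 0 := (IsAlgClosed.splits p).roots_ne_zero (by omega)
    rw [h2, ← Complex.reCLM_apply, map_multiset_sum, Multiset.map_map]
    have : ∀ s : Multiset ℂ, s ≠ 0 → (∀ z ∈ s, 0 < ((-(u * z))⁻¹).re) →
        0 < (s.map (Complex.reCLM ∘ fun z => (-(u * z))⁻¹)).sum := by
      intro s
      induction s using Multiset.induction_on with
      | empty => simp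
      | cons a s ih =>
        intro _ h
        rw [Multiset.map_cons, Multiset.sum_cons]
        have ha : 0 < (Complex.reCLM ∘ fun z => (-(u * z))⁻¹) a := h a (by simp)
        rcases eq_or_ne s 0 with rfl | hs
        · simpa using ha
        · exact add_pos ha (ih hs fun z hz => h z (by simp [hz]))
    exact this _ hne h3
  | succ k ih =>
    intro p h0 hp
    have key : 0 < p.natDegree → _ := fun hd => ih (p := derivative p) (by
      intro h
      have := derivative_eq_zero.mp h
      omega) (re_mul_neg_of_isRoot_derivative hd hp)
    have hnd := natDegree_derivative p
    refine ⟨fun hk => ?_, fun hk => ?_⟩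
    · have := (key (by omega)).1 (by omega)
      rw [coeff_derivative] at this
      exact left_ne_zero_of_mul this
    · have := (key (by omega)).2 (by omega)
      rw [coeff_derivative, coeff_derivative] at this
      have e : p.coeff (k + 1 + 1) * (((k + 1 : ℕ) : ℂ) + 1) /
          (u * (p.coeff (k + 1) * ((k : ℂ) + 1)))
          = ((((k : ℝ) + 2) / ((k : ℝ) + 1) : ℝ) : ℂ)
            * (p.coeff (k + 1 + 1) / (u * p.coeff (k + 1))) := by
        push_cast
        rw [div_mul_div_comm]
        congr 1 <;> ring
      rw [e, Complex.re_ofReal_mul] at this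
      exact pos_of_mul_pos_right this (by positivity)

/-- A real polynomial without nonreal zeros splits. -/
theorem splits_of_aeval_ne_zero {f : ℝ[X]} (h : ∀ t : ℂ, 0 < t.im → aeval t f ≠ 0) :
    f.Splits := by
  refine Splits.of_splits_map (algebraMap ℝ ℂ) (IsAlgClosed.splits _) fun a ha => ?_
  have ha : aeval a f = 0 := by
    have := isRoot_of_mem_roots ha
    rwa [IsRoot, eval_map_algebraMap] at this
  have him : a.im = 0 := by
    rcases lt_trichotomy a.im 0 with hlt | heq | hgt
    · exact absurd (by rw [aeval_conj, ha, map_zero]) (h (starRingEnd ℂ a) (by simpa using hlt))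
    · exact heq
    · exact absurd ha (h a hgt)
  exact ⟨a.re, Complex.ext (by simp) (by simp [him])⟩

/-! ### Proper pairs and partial fractions -/

/-- The quotient `f / g` maps the open upper half-plane to its closure. -/
def Proper (g f : ℝ[X]) : Prop :=
  ∀ t : ℂ, 0 < t.im → 0 ≤ (aeval t f * starRingEnd ℂ (aeval t g)).im

/-- The cone generated by the polynomials obtained from `f` by deleting one zero. -/
noncomputable def deletionCone (f : ℝ[X]) : AddSubmonoid ℝ[X] :=
  AddSubmonoid.closure {q | ∃ c α : ℝ, 0 ≤ c ∧ (X - C α) * q = C c * f}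

theorem mul_mem_deletionCone {f g : ℝ[X]} (h : ℝ[X]) (hg : g ∈ deletionCone f) :
    h * g ∈ deletionCone (h * f) := by
  induction hg using AddSubmonoid.closure_induction with
  | mem q hq =>
    obtain ⟨c, α, hc, hq⟩ := hq
    exact AddSubmonoid.subset_closure ⟨c, α, hc, by linear_combination h * hq⟩
  | zero => simp
  | add x y _ _ hx hy => rw [mul_add]; exact add_mem hx hy

/-- A common real factor h only contributes |h(t)|², so it can be cancelled where it does not
vanish. -/
theorem Proper.of_mul {g f h : ℝ[X]} (hP : Proper (h * g) (h * f))
    (hroot : ∀ t : ℂ, 0 < t.im → aeval t h ≠ 0) : Proper g f := by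
  intro t ht
  have := hP t ht
  have e : aeval t (h * f) * starRingEnd ℂ (aeval t (h * g)) =
      ((Complex.normSq (aeval t h) : ℝ) : ℂ) * (aeval t f * starRingEnd ℂ (aeval t g)) := by
    rw [map_mul, map_mul, map_mul, Complex.normSq_eq_conj_mul_self]
    ring
  rw [e, Complex.im_ofReal_mul] at this
  exact nonneg_of_mul_nonneg_right this (Complex.normSq_pos.mpr (hroot t ht))

theorem Proper.mul {g f : ℝ[X]} (h : ℝ[X]) (hP : Proper g f) : Proper (h * g) (h * f) := by
  intro t ht
  have e : aeval t (h * f) * starRingEnd ℂ (aeval t (h * g)) =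
      ((Complex.normSq (aeval t h) : ℝ) : ℂ) * (aeval t f * starRingEnd ℂ (aeval t g)) := by
    rw [map_mul, map_mul, map_mul, Complex.normSq_eq_conj_mul_self]
    ring
  rw [e, Complex.im_ofReal_mul]
  exact mul_nonneg (Complex.normSq_nonneg _) (hP t ht)

theorem aeval_X_sub_C_ne_zero (α : ℝ) (t : ℂ) (ht : 0 < t.im) :
    aeval t (X - C α : ℝ[X]) ≠ 0 := by
  intro h
  have := congrArg Complex.im h
  simp at this
  exact ht.ne' this

/-- The behaviour of a proper quotient along rays at a zero of order `k` of `f`. -/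
theorem Proper.sin_nonneg {g u : ℝ[X]} {α : ℝ} {k : ℕ} (hP : Proper g ((X - C α) ^ k * u))
    {φ : ℝ} (h0 : 0 < φ) (hpi : φ < Real.pi) :
    0 ≤ Real.sin (k * φ) * (u.eval α * g.eval α) := by
  let w : ℂ := Complex.exp (φ * Complex.I)
  have hw : w.im = Real.sin φ := by simp [w, Complex.exp_ofReal_mul_I_im]
  let F : ℝ → ℝ := fun ε => (w ^ k * (aeval ((α : ℂ) + ε * w) u *
    starRingEnd ℂ (aeval ((α : ℂ) + ε * w) g))).im
  have hF : Continuous F := by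
    have : ∀ q : ℝ[X], Continuous fun ε : ℝ => aeval ((α : ℂ) + ε * w) q := fun q =>
      (q.continuous_aeval).comp (by fun_prop)
    have h1 := this u
    have h2 := this g
    exact Complex.continuous_im.comp
      (continuous_const.mul (h1.mul (Complex.continuous_conj.comp h2)))
  have hpos : ∀ ε : ℝ, 0 < ε → 0 ≤ F ε := by
    intro ε hε
    have him : 0 < ((α : ℂ) + ε * w).im := by
      have := mul_pos hε (Real.sin_pos_of_pos_of_lt_pi h0 hpi)
      rw [← hw] at this
      simpa using this
    have := hP _ him
    have e : aeval ((α : ℂ) + ε * w) ((X - C α) ^ k * u) *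
        starRingEnd ℂ (aeval ((α : ℂ) + ε * w) g) = ((ε ^ k : ℝ) : ℂ) *
        (w ^ k * (aeval ((α : ℂ) + ε * w) u * starRingEnd ℂ (aeval ((α : ℂ) + ε * w) g))) := by
      simp [mul_pow]
      ring
    rw [e, Complex.im_ofReal_mul] at this
    exact nonneg_of_mul_nonneg_right this (by positivity)
  have hlim : Filter.Tendsto F (nhdsWithin 0 (Set.Ioi 0)) (nhds (F 0)) :=
    (hF.tendsto 0).mono_left nhdsWithin_le_nhds
  have hF0 : 0 ≤ F 0 := ge_of_tendsto hlim
    (Filter.eventually_of_mem self_mem_nhdsWithin fun ε hε => hpos ε hε)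
  have ev : ∀ q : ℝ[X], aeval (α : ℂ) q = ((q.eval α : ℝ) : ℂ) := fun q =>
    aeval_algebraMap_apply_eq_algebraMap_eval α q
  have e0 : F 0 = Real.sin (k * φ) * (u.eval α * g.eval α) := by
    have hwk : w ^ k = Complex.exp (((k * φ : ℝ) : ℂ) * Complex.I) := by
      rw [← Complex.exp_nat_mul]
      congr 1
      push_cast
      ring
    simp only [F, Complex.ofReal_zero, zero_mul, add_zero, ev, Complex.conj_ofReal, hwk]
    rw [← Complex.ofReal_mul, Complex.im_mul_ofReal, Complex.exp_ofReal_mul_I_im]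
  rwa [e0] at hF0

/-- A proper pair without common zeros: the zeros of `f` are simple with positive residues. -/
theorem Proper.residue_pos {g f : ℝ[X]} (hP : Proper g f) (hf : f ≠ 0) {α : ℝ}
    (hα : f.eval α = 0) (hg : g.eval α ≠ 0) :
    f.rootMultiplicity α = 1 ∧ 0 < (derivative f).eval α * g.eval α := by
  obtain ⟨u, hu, hdvd⟩ := exists_eq_pow_rootMultiplicity_mul_and_not_dvd f hf α
  set k := f.rootMultiplicity α with hk
  have hk1 : 1 ≤ k := (rootMultiplicity_pos hf).mpr hα
  have hu0 : u.eval α ≠ 0 := fun h => hdvd (dvd_iff_isRoot.mpr h)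
  have hP' : Proper g ((X - C α) ^ k * u) := hu ▸ hP
  have hkpos : (0 : ℝ) < k := by exact_mod_cast hk1
  have hpos : 0 < u.eval α * g.eval α := by
    -- The ray at angle π/(2k) gives sin(kφ) = 1, which fixes the sign of the residue.
    have h := hP'.sin_nonneg (φ := Real.pi / (2 * k)) (by positivity) (by
      rw [div_lt_iff₀ (by positivity)]
      have : (1 : ℝ) ≤ k := by exact_mod_cast hk1
      nlinarith [Real.pi_pos])
    rw [show (k : ℝ) * (Real.pi / (2 * k)) = Real.pi / 2 by field_simp, Real.sin_pi_div_two,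
      one_mul] at h
    exact lt_of_le_of_ne h (mul_ne_zero hu0 hg).symm
  have hkeq : k = 1 := by
    by_contra hne
    have hk2 : (2 : ℝ) ≤ k := by exact_mod_cast (by omega : 2 ≤ k)
    -- For k ≥ 2 the angle 3π/(2k) is still below π and gives sin(kφ) = -1, contradicting that sign.
    have h := hP'.sin_nonneg (φ := 3 * Real.pi / (2 * k)) (by positivity) (by
      rw [div_lt_iff₀ (by positivity)]
      nlinarith [Real.pi_pos])
    rw [show (k : ℝ) * (3 * Real.pi / (2 * k)) = Real.pi / 2 + Real.pi by field_simp; ring,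
      Real.sin_add_pi, Real.sin_pi_div_two] at h
    linarith
  refine ⟨hkeq, ?_⟩
  rw [hu, hkeq]
  simpa using hpos

/-- Induction on proper pairs by removing common zeros. -/
theorem Proper.induction {motive : ℝ[X] → ℝ[X] → Prop}
    (cons : ∀ (α : ℝ) (g f : ℝ[X]), g ≠ 0 → f ≠ 0 → motive g f →
      motive ((X - C α) * g) ((X - C α) * f))
    (simple : ∀ g f : ℝ[X], g ≠ 0 → f ≠ 0 → f.Splits → f.natDegree = g.natDegree + 1 →
      f.roots.Nodup → (∀ α, f.eval α = 0 → 0 < (derivative f).eval α * g.eval α) → motive g f)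
    {g f : ℝ[X]} (hg : g ≠ 0) (hf : f ≠ 0) (hs : f.Splits) (hd : f.natDegree = g.natDegree + 1)
    (hP : Proper g f) : motive g f := by
  induction hn : g.natDegree generalizing g f with
  | zero =>
    have hgc : ∀ α : ℝ, g.eval α ≠ 0 := by
      rw [eq_C_of_natDegree_eq_zero hn] at hg ⊢
      intro α h
      rw [eval_C] at h
      exact hg (by rw [h, C_0])
    refine simple g f hg hf hs hd ?_ fun α hα => (hP.residue_pos hf hα (hgc α)).2
    rw [Multiset.nodup_iff_count_le_one]
    intro α
    rw [count_roots]
    by_cases hα : f.eval α = 0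
    · exact (hP.residue_pos hf hα (hgc α)).1.le
    · rw [rootMultiplicity_eq_zero hα]; omega
  | succ n ih =>
    by_cases hc : ∃ α, f.eval α = 0 ∧ g.eval α = 0
    · obtain ⟨α, hfα, hgα⟩ := hc
      obtain ⟨f₁, rfl⟩ := dvd_iff_isRoot.mpr hfα
      obtain ⟨g₁, rfl⟩ := dvd_iff_isRoot.mpr hgα
      have hf₁ := right_ne_zero_of_mul hf
      have hg₁ := right_ne_zero_of_mul hg
      have hX := X_sub_C_ne_zero α
      rw [natDegree_mul hX hf₁, natDegree_mul hX hg₁, natDegree_X_sub_C] at hd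
      rw [natDegree_mul hX hg₁, natDegree_X_sub_C] at hn
      exact cons α g₁ f₁ hg₁ hf₁ (ih hg₁ hf₁ (splits_X_sub_C_mul_iff.mp hs) (by omega)
        (hP.of_mul (aeval_X_sub_C_ne_zero α)) (by omega))
    · push Not at hc
      refine simple g f hg hf hs hd ?_ fun α hα => (hP.residue_pos hf hα (hc α hα)).2
      rw [Multiset.nodup_iff_count_le_one]
      intro α
      rw [count_roots]
      by_cases hα : f.eval α = 0
      · exact (hP.residue_pos hf hα (hc α hα)).1.le
      · rw [rootMultiplicity_eq_zero hα]; omega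

/-- Once common zeros are removed this is Lagrange interpolation at the simple zeros of f: g = Σ
g(α)/f'(α) · f/(X - α), with coefficients made nonnegative by the sign of the residues. Common
factors are restored by `mul_mem_deletionCone`. -/
theorem Proper.mem_deletionCone {g f : ℝ[X]} (hg : g ≠ 0) (hf : f ≠ 0) (hs : f.Splits)
    (hd : f.natDegree = g.natDegree + 1) (hP : Proper g f) : g ∈ deletionCone f := by
  refine Proper.induction (motive := fun g f => g ∈ deletionCone f)
    (fun α g f _ _ h => mul_mem_deletionCone _ h) ?_ hg hf hs hd hP
  intro g f hg hf hs hd hnd hres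
  have key : g = ∑ α ∈ f.roots.toFinset,
      C (g.eval α / (derivative f).eval α) * (f /ₘ (X - C α)) := by
    have hcard : f.roots.toFinset.card = f.natDegree := by
      rw [Multiset.toFinset_card_of_nodup hnd, hs.natDegree_eq_card_roots]
    have hdiv : ∀ α ∈ f.roots.toFinset, (X - C α) * (f /ₘ (X - C α)) = f := by
      intro α hα
      exact mul_divByMonic_eq_iff_isRoot.mpr (isRoot_of_mem_roots (Multiset.mem_toFinset.mp hα))
    refine eq_of_degrees_lt_of_eval_finset_eq f.roots.toFinset ?_ ?_ ?_
    · rw [hcard, degree_eq_natDegree hg]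
      exact_mod_cast (by omega : g.natDegree < f.natDegree)
    · rw [hcard]
      refine (degree_sum_le _ _).trans_lt ?_
      rw [Finset.sup_lt_iff (WithBot.bot_lt_coe _)]
      intro α hα
      rw [C_mul']
      refine (degree_smul_le _ _).trans_lt ?_
      rw [← degree_eq_natDegree hf]
      exact degree_divByMonic_lt _ _ hf (by rw [degree_X_sub_C]; exact zero_lt_one)
    · intro β hβ
      rw [eval_finsetSum, Finset.sum_eq_single_of_mem β hβ]
      · have hfβ : f.eval β = 0 := isRoot_of_mem_roots (Multiset.mem_toFinset.mp hβ)
        have hd' : (derivative f).eval β = (f /ₘ (X - C β)).eval β := by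
          conv_lhs => rw [← hdiv β hβ]
          simp
        have := left_ne_zero_of_mul (hres β hfβ).ne'
        rw [eval_mul, eval_C, ← hd', div_mul_cancel₀ _ this]
      · intro α hα hne
        have hfβ : f.eval β = 0 := isRoot_of_mem_roots (Multiset.mem_toFinset.mp hβ)
        rw [← hdiv α hα, eval_mul] at hfβ
        have : (f /ₘ (X - C α)).eval β = 0 := by
          refine (mul_eq_zero.mp hfβ).resolve_left ?_
          simpa [sub_eq_zero] using hne.symm
        rw [eval_mul, this, mul_zero]
  rw [key]
  refine sum_mem fun α hα => AddSubmonoid.subset_closure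
    ⟨g.eval α / (derivative f).eval α, α, ?_, ?_⟩
  · have h := hres α (isRoot_of_mem_roots (Multiset.mem_toFinset.mp hα))
    rcases mul_pos_iff.mp h with h | h
    · exact (div_pos h.2 h.1).le
    · exact (div_pos_of_neg_of_neg h.2 h.1).le
  · have : (X - C α) * (f /ₘ (X - C α)) = f :=
      mul_divByMonic_eq_iff_isRoot.mpr (isRoot_of_mem_roots (Multiset.mem_toFinset.mp hα))
    linear_combination C (g.eval α / (derivative f).eval α) * this

/-! ### From properness to interlacing -/

/-- The number of zeros of `f` that are at most `x`, with multiplicity. -/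
noncomputable def rootCount (f : ℝ[X]) (x : ℝ) : ℕ := f.roots.countP (· ≤ x)

theorem rootCount_X_sub_C_mul {f : ℝ[X]} (hf : f ≠ 0) (α x : ℝ) :
    rootCount ((X - C α) * f) x = rootCount f x + if α ≤ x then 1 else 0 := by
  rw [rootCount, roots_mul (mul_ne_zero (X_sub_C_ne_zero α) hf), roots_X_sub_C,
    Multiset.singleton_add, Multiset.countP_cons, rootCount]

theorem rootCount_eq_card {f : ℝ[X]} {n : ℕ} {α : Fin n → ℝ}
    (h : f.roots = Finset.univ.val.map α) (x : ℝ) :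
    rootCount f x = (Finset.univ.filter fun i => α i ≤ x).card := by
  rw [rootCount, h, Multiset.countP_map]
  rfl

theorem exists_monotone_roots {f : ℝ[X]} {n : ℕ} (hn : f.roots.card = n) :
    ∃ α : Fin n → ℝ, Monotone α ∧ f.roots = Finset.univ.val.map α := by
  have hl : (f.roots.sort (· ≤ ·)).length = n := by rw [Multiset.length_sort, hn]
  refine ⟨fun i => (f.roots.sort (· ≤ ·)).get (i.cast hl.symm), ?_, ?_⟩
  · intro i j hij
    exact (f.roots.pairwise_sort (· ≤ ·)).sortedLE.monotone_get (by simpa using hij)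
  · conv_lhs => rw [← Multiset.sort_eq f.roots (· ≤ ·)]
    subst hl
    generalize f.roots.sort (· ≤ ·) = l
    simp

/-- Consecutive simple zeros of `f` with residues of the same sign enclose a zero of `g`. -/
theorem exists_root_between {g f : ℝ[X]} {a b : ℝ} (hab : a < b) (ha : f.eval a = 0)
    (hb : f.eval b = 0) (hne : ∀ x, a < x → x < b → f.eval x ≠ 0)
    (hra : 0 < (derivative f).eval a * g.eval a) (hrb : 0 < (derivative f).eval b * g.eval b) :
    ∃ x, a < x ∧ x < b ∧ g.eval x = 0 := by
  obtain ⟨v, rfl⟩ := dvd_iff_isRoot.mpr ha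
  have hvb : v.eval b = 0 := by
    rw [eval_mul] at hb
    refine (mul_eq_zero.mp hb).resolve_left ?_
    simpa [sub_eq_zero] using hab.ne'
  obtain ⟨u, rfl⟩ := dvd_iff_isRoot.mpr hvb
  have hda : (derivative ((X - C a) * ((X - C b) * u))).eval a = (a - b) * u.eval a := by simp
  have hdb : (derivative ((X - C a) * ((X - C b) * u))).eval b = (b - a) * u.eval b := by simp
  rw [hda] at hra
  rw [hdb] at hrb
  have hu : ∀ x ∈ Set.Icc a b, u.eval x ≠ 0 := by
    intro x hx h
    rcases hx.1.eq_or_lt with rfl | hxa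
    · simp [h] at hra
    rcases hx.2.eq_or_lt with rfl | hxb
    · simp [h] at hrb
    exact hne x hxa hxb (by simp [h])
  have hsame : 0 < u.eval a * u.eval b := by
    by_contra! hcon
    have hz : (0 : ℝ) ∈ Set.uIcc (u.eval a) (u.eval b) := by
      rw [Set.mem_uIcc]
      rcases mul_nonpos_iff.mp hcon with h | h
      · exact Or.inr ⟨h.2, h.1⟩
      · exact Or.inl ⟨h.1, h.2⟩
    obtain ⟨x, hx, hx0⟩ := intermediate_value_uIcc (u.continuousOn (s := Set.uIcc a b)) hz
    rw [Set.uIcc_of_le hab.le] at hx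
    exact hu x hx hx0
  -- As u keeps its sign on [a, b], the factors a - b and b - a give the derivative of f opposite
  -- signs at a and b; g must follow.
  have hopp : g.eval a * g.eval b < 0 := by
    have h1 : 0 < ((a - b) * u.eval a * g.eval a) * ((b - a) * u.eval b * g.eval b) :=
      mul_pos hra hrb
    have h2 : ((a - b) * u.eval a * g.eval a) * ((b - a) * u.eval b * g.eval b) =
      -(((b - a) ^ 2 * (u.eval a * u.eval b)) * (g.eval a * g.eval b)) := by ring
    rw [h2, neg_pos] at h1
    have h3 : 0 < (b - a) ^ 2 * (u.eval a * u.eval b) :=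
      mul_pos (pow_pos (sub_pos.mpr hab) 2) hsame
    exact (pos_iff_neg_of_mul_neg h1).mp h3
  have hz : (0 : ℝ) ∈ Set.uIcc (g.eval a) (g.eval b) := by
    rw [Set.mem_uIcc]
    rcases mul_neg_iff.mp hopp with h | h
    · exact Or.inr ⟨h.2.le, h.1.le⟩
    · exact Or.inl ⟨h.1.le, h.2.le⟩
  obtain ⟨x, hx, hx0⟩ := intermediate_value_uIcc (g.continuousOn (s := Set.uIcc a b)) hz
  rw [Set.uIcc_of_le hab.le] at hx
  refine ⟨x, lt_of_le_of_ne hx.1 ?_, lt_of_le_of_ne hx.2 ?_, hx0⟩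
  · rintro rfl
    simp [hx0] at hopp
  · rintro rfl
    simp [hx0] at hopp

/-- Each of the deg g gaps between consecutive zeros of f contains a zero of g. By degree these are
all the zeros of g, and they are simple. -/
theorem rootCount_bounds_of_simple {g f : ℝ[X]} (hg : g ≠ 0) (hs : f.Splits)
    (hd : f.natDegree = g.natDegree + 1) (hnd : f.roots.Nodup)
    (hres : ∀ α, f.eval α = 0 → 0 < (derivative f).eval α * g.eval α) :
    g.Splits ∧ ∀ x, rootCount g x ≤ rootCount f x ∧ rootCount f x ≤ rootCount g x + 1 := by
  have hf : f ≠ 0 := by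
    rintro rfl
    simp at hd
  obtain ⟨α, hαm, hα⟩ := exists_monotone_roots (hs.natDegree_eq_card_roots.symm.trans hd)
  have hαinj : Function.Injective α := by
    rw [hα, Multiset.nodup_map_iff_inj_on Finset.univ.nodup] at hnd
    exact fun i j h => hnd i (Finset.mem_univ i) j (Finset.mem_univ j) h
  have hαs : StrictMono α := hαm.strictMono_of_injective hαinj
  have hroot : ∀ x, f.eval x = 0 ↔ ∃ i, α i = x := by
    intro x
    rw [← IsRoot.def, ← mem_roots hf, hα, Multiset.mem_map]
    exact ⟨fun ⟨i, _, h⟩ => ⟨i, h⟩, fun ⟨i, h⟩ => ⟨i, Finset.mem_univ i, h⟩⟩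
  have hex : ∀ i : Fin g.natDegree, ∃ x, α i.castSucc < x ∧ x < α i.succ ∧ g.eval x = 0 := by
    intro i
    have ha := (hroot (α i.castSucc)).mpr ⟨_, rfl⟩
    have hb := (hroot (α i.succ)).mpr ⟨_, rfl⟩
    refine exists_root_between (hαs i.castSucc_lt_succ) ha hb ?_ (hres _ ha) (hres _ hb)
    intro x hx1 hx2 hx
    obtain ⟨j, rfl⟩ := (hroot x).mp hx
    rw [hαs.lt_iff_lt, Fin.lt_def] at hx1 hx2
    simp only [Fin.val_castSucc, Fin.val_succ] at hx1 hx2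
    omega
  choose β hβ1 hβ2 hβ0 using hex
  have hβs : StrictMono β := by
    intro i j hij
    refine (hβ2 i).trans_le (le_trans (hαm ?_) (hβ1 j).le)
    rw [Fin.le_def]
    simpa using hij
  have hsub : (Finset.univ.val.map β) ≤ g.roots := by
    rw [Multiset.le_iff_subset (Multiset.Nodup.map hβs.injective Finset.univ.nodup)]
    intro x hx
    obtain ⟨i, _, rfl⟩ := Multiset.mem_map.mp hx
    exact (mem_roots hg).mpr (hβ0 i)
  have hβ : g.roots = Finset.univ.val.map β := by
    refine (Multiset.eq_of_le_of_card_le hsub ?_).symm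
    simpa using card_roots' g
  refine ⟨?_, fun x => ?_⟩
  · rw [splits_iff_card_roots, hβ]
    simp
  · rw [rootCount_eq_card hα, rootCount_eq_card hβ]
    constructor
    · refine Finset.card_le_card_of_injOn Fin.castSucc ?_ (Fin.castSucc_injective _).injOn
      intro i hi
      simp only [Finset.coe_filter, Finset.mem_univ, true_and, Set.mem_ofPred_eq] at hi ⊢
      exact (hβ1 i).le.trans hi
    · calc (Finset.univ.filter fun i => α i ≤ x).card
          ≤ (insert 0 ((Finset.univ.filter fun i => β i ≤ x).image Fin.succ)).card := by
            refine Finset.card_le_card fun i hi => ?_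
            rw [Finset.mem_filter] at hi
            rw [Finset.mem_insert]
            refine Fin.cases (fun _ => Or.inl rfl) (fun j hj => Or.inr ?_) i hi.2
            rw [Finset.mem_image]
            exact ⟨j, by simpa using (hβ2 j).le.trans hj, rfl⟩
        _ ≤ _ := (Finset.card_insert_le _ _).trans (Nat.add_le_add_right Finset.card_image_le 1)

/-- Counting zeros up to x is the form of interlacing that survives restoring a common factor X - α:
both counts change by the same amount, with no re-sorting of the lists of zeros. -/
theorem Proper.rootCount_bounds {g f : ℝ[X]} (hg : g ≠ 0) (hf : f ≠ 0) (hs : f.Splits)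
    (hd : f.natDegree = g.natDegree + 1) (hP : Proper g f) :
    g.Splits ∧ ∀ x, rootCount g x ≤ rootCount f x ∧ rootCount f x ≤ rootCount g x + 1 := by
  refine Proper.induction (motive := fun g f => g.Splits ∧
    ∀ x, rootCount g x ≤ rootCount f x ∧ rootCount f x ≤ rootCount g x + 1)
    (fun α g f hg hf h => ⟨splits_X_sub_C_mul_iff.mpr h.1, fun x => ?_⟩)
    (fun g f hg _ hs hd hnd hres => rootCount_bounds_of_simple hg hs hd hnd hres) hg hf hs hd hP
  rw [rootCount_X_sub_C_mul hg, rootCount_X_sub_C_mul hf]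
  have := h.2 x
  omega

/-- Were β i < α i, then at x = β i the polynomial g would have at least i + 1 zeros up to x and f
at most i. The other inequality is similar, with x = α (i + 1). -/
theorem interlaces_of_rootCount {g f : ℝ[X]} (hg : g ≠ 0) (hf : f ≠ 0) (hgs : g.Splits)
    (hs : f.Splits) (hd : f.natDegree = g.natDegree + 1)
    (h : ∀ x, rootCount g x ≤ rootCount f x ∧ rootCount f x ≤ rootCount g x + 1) :
    Interlaces g f := by
  obtain ⟨α, hαm, hα⟩ := exists_monotone_roots (hs.natDegree_eq_card_roots.symm.trans hd)
  obtain ⟨β, hβm, hβ⟩ := exists_monotone_roots hgs.natDegree_eq_card_roots.symm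
  have lower : ∀ {n : ℕ} {γ : Fin n → ℝ}, Monotone γ → ∀ i : Fin n,
      (i : ℕ) + 1 ≤ (Finset.univ.filter fun j => γ j ≤ γ i).card := by
    intro n γ hγ i
    rw [← Fin.card_Iic i]
    refine Finset.card_le_card fun j hj => ?_
    simpa using hγ (Finset.mem_Iic.mp hj)
  have upper : ∀ {n : ℕ} {γ : Fin n → ℝ}, Monotone γ → ∀ (i : Fin n) x, x < γ i →
      (Finset.univ.filter fun j => γ j ≤ x).card ≤ i := by
    intro n γ hγ i x hx
    rw [← Fin.card_Iio i]
    refine Finset.card_le_card fun j hj => ?_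
    rw [Finset.mem_Iio]
    exact hγ.reflect_lt ((Finset.mem_filter.mp hj).2.trans_lt hx)
  refine ⟨hg, hf, hgs, hs, hd, α, β, hαm, hβm, hα, hβ, fun i => ⟨?_, ?_⟩⟩
  · by_contra! hlt
    have h1 := (h (β i)).1
    rw [rootCount_eq_card hα, rootCount_eq_card hβ] at h1
    have h2 := lower hβm i
    have h3 := upper hαm _ _ hlt
    rw [Fin.val_castSucc] at h3
    omega
  · by_contra! hlt
    have h1 := (h (α i.succ)).2
    rw [rootCount_eq_card hα, rootCount_eq_card hβ] at h1
    have h2 := lower hαm i.succ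
    have h3 := upper hβm _ _ hlt
    rw [Fin.val_succ] at h2
    omega

theorem Proper.interlaces {g f : ℝ[X]} (hg : g ≠ 0) (hf : f ≠ 0) (hs : f.Splits)
    (hd : f.natDegree = g.natDegree + 1) (hP : Proper g f) : Interlaces g f :=
  have h := hP.rootCount_bounds hg hf hs hd
  interlaces_of_rootCount hg hf h.1 hs hd h.2

/-! ### The diamond product -/

/-- The expansion of `choose n i * choose n j` in the basis `choose n k`, with `X ^ k` standing for
`choose n k`. -/
noncomputable def diamondMonomial : ℕ → ℕ → ℝ[X]
  | 0, j => X ^ j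
  | i + 1, 0 => X ^ (i + 1)
  -- The bracket represents the forward difference in n of choose n (i + 1) * choose n (j + 1).
  -- Multiplication by X sums it back, as X * f vanishes at n = 0 and has difference f.
  | i + 1, j + 1 =>
    X * (diamondMonomial (i + 1) j + diamondMonomial i (j + 1) + diamondMonomial i j)

/-- The bilinear product on polynomials that corresponds to the product of the functions
`∑ k, f.coeff k * choose n k`. -/
noncomputable def diamond (f g : ℝ[X]) : ℝ[X] :=
  f.sum fun i a => g.sum fun j b => C (a * b) * diamondMonomial i j

/-- `∑ k, f.coeff k * choose n k`. -/
noncomputable def chooseEval (n : ℕ) : ℝ[X] →ₗ[ℝ] ℝ :=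
  Polynomial.lsum fun k => (n.choose k : ℝ) • LinearMap.id

theorem chooseEval_monomial (n k : ℕ) (a : ℝ) :
    chooseEval n (monomial k a) = n.choose k * a := by
  simp [chooseEval, Polynomial.lsum_apply, sum_monomial_index]

theorem chooseEval_X_pow (n k : ℕ) : chooseEval n (X ^ k) = n.choose k := by
  rw [X_pow_eq_monomial, chooseEval_monomial, mul_one]

theorem chooseEval_succ_X_mul (n : ℕ) (f : ℝ[X]) :
    chooseEval (n + 1) (X * f) = chooseEval n (X * f) + chooseEval n f := by
  induction f using Polynomial.induction_on' with
  | add p q hp hq => simp only [mul_add, map_add, hp, hq]; ring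
  | monomial k a =>
    rw [X_mul_monomial, chooseEval_monomial, chooseEval_monomial, chooseEval_monomial,
      Nat.choose_succ_succ]
    push_cast
    ring

theorem chooseEval_zero_X_mul (f : ℝ[X]) : chooseEval 0 (X * f) = 0 := by
  induction f using Polynomial.induction_on' with
  | add p q hp hq => simp [mul_add, hp, hq]
  | monomial k a => rw [X_mul_monomial, chooseEval_monomial]; simp

theorem chooseEval_diamondMonomial (n : ℕ) : ∀ i j,
    chooseEval n (diamondMonomial i j) = n.choose i * n.choose j := by
  induction n with
  | zero =>
    intro i j
    rcases i with _ | i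
    · simp [diamondMonomial, chooseEval_X_pow]
    rcases j with _ | j
    · simp [diamondMonomial, chooseEval_X_pow]
    rw [diamondMonomial, chooseEval_zero_X_mul]
    simp
  | succ n ih =>
    intro i j
    rcases i with _ | i
    · simp [diamondMonomial, chooseEval_X_pow]
    rcases j with _ | j
    · simp [diamondMonomial, chooseEval_X_pow]
    rw [diamondMonomial, chooseEval_succ_X_mul, ← diamondMonomial, map_add, map_add, ih, ih, ih,
      ih, Nat.choose_succ_succ, Nat.choose_succ_succ]
    push_cast
    ring

theorem chooseEval_diamond (n : ℕ) (f g : ℝ[X]) :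
    chooseEval n (diamond f g) = chooseEval n f * chooseEval n g := by
  have h : ∀ p : ℝ[X], chooseEval n p = p.sum fun i a => n.choose i * a := by
    intro p
    simp [chooseEval, Polynomial.lsum_apply]
  rw [h f, h g, diamond]
  simp only [Polynomial.sum, map_sum, Finset.sum_mul_sum]
  refine Finset.sum_congr rfl fun i _ => Finset.sum_congr rfl fun j _ => ?_
  rw [← smul_eq_C_mul, map_smul, chooseEval_diamondMonomial, smul_eq_mul]
  ring

/-- The matrix choose n k is unitriangular, so the values determine the coefficients one after the
other. Identities for `diamond` thereby reduce to identities between products of numbers. -/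
theorem eq_of_chooseEval_eq {f g : ℝ[X]} (h : ∀ n, chooseEval n f = chooseEval n g) : f = g := by
  rw [← sub_eq_zero]
  have h' : ∀ n, chooseEval n (f - g) = 0 := fun n => by rw [map_sub, h, sub_self]
  generalize f - g = p at h'
  ext n
  rw [coeff_zero]
  induction n using Nat.strong_induction_on with
  | _ n ih =>
    have hn := h' n
    simp only [chooseEval, Polynomial.lsum_apply] at hn
    rw [Polynomial.sum, Finset.sum_eq_single n] at hn
    · simpa using hn
    · intro k _ hk
      rcases lt_or_gt_of_ne hk with hlt | hgt
      · simp [ih k hlt]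
      · simp [Nat.choose_eq_zero_of_lt hgt]
    · intro hn'
      simp [notMem_support_iff.mp hn']

/-! ### The diamond product as a constant coefficient -/

section Evaluation

variable (t : ℂ)

/-- The substitution of `t + y` into a real polynomial. -/
noncomputable def substLeft : ℝ[X] →ₐ[ℝ] ℂ[T;T⁻¹] :=
  aeval (LaurentPolynomial.C t + LaurentPolynomial.T 1)

/-- The substitution of `t + t * (t + 1) * y⁻¹` into a real polynomial. -/
noncomputable def substRight : ℝ[X] →ₐ[ℝ] ℂ[T;T⁻¹] :=
  aeval (LaurentPolynomial.C t + LaurentPolynomial.C (t * (t + 1)) * LaurentPolynomial.T (-1))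

theorem coeff_C_mul (a : ℂ) (p : ℂ[T;T⁻¹]) (n : ℤ) :
    (LaurentPolynomial.C a * p).coeff n = a * p.coeff n := by
  rw [← LaurentPolynomial.smul_eq_C_mul]
  simp

theorem coeff_T_mul (m : ℤ) (p : ℂ[T;T⁻¹]) (n : ℤ) :
    (LaurentPolynomial.T m * p).coeff n = p.coeff (n - m) := by
  rw [LaurentPolynomial.T, AddMonoidAlgebra.coeff_single_mul_apply, one_mul, neg_add_eq_sub]

theorem coeff_toLaurent_natCast (p : ℂ[X]) (n : ℕ) :
    (Polynomial.toLaurent p).coeff (n : ℤ) = p.coeff n := by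
  rw [LaurentPolynomial.coeff_toLaurent]
  exact Finsupp.mapDomain_apply Nat.cast_injective _ _

theorem substLeft_X : substLeft t X = LaurentPolynomial.C t + LaurentPolynomial.T 1 := by
  simp [substLeft]

theorem substRight_X : substRight t X =
    LaurentPolynomial.C t + LaurentPolynomial.C (t * (t + 1)) * LaurentPolynomial.T (-1) := by
  simp [substRight]

theorem substLeft_C (a : ℝ) : substLeft t (C a) = LaurentPolynomial.C (a : ℂ) := by
  rw [substLeft, aeval_C]; rfl

theorem substRight_C (a : ℝ) : substRight t (C a) = LaurentPolynomial.C (a : ℂ) := by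
  rw [substRight, aeval_C]; rfl

/-- With a = t + y and b = t + t(t + 1)/y this is ab = t(a + b + 1), the recursion of
`diamondMonomial` at X = t; it dictates the constant t(t + 1). -/
theorem subst_recursion (f g : ℝ[X]) :
    substLeft t (X * f) * substRight t (X * g) = LaurentPolynomial.C t *
      (substLeft t (X * f) * substRight t g + substLeft t f * substRight t (X * g) +
        substLeft t f * substRight t g) := by
  have hT : (LaurentPolynomial.T 1 * LaurentPolynomial.T (-1) : ℂ[T;T⁻¹]) = 1 := by
    rw [← LaurentPolynomial.T_add]; simp
  simp only [map_mul, substLeft_X, substRight_X, map_add, map_one]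
  linear_combination (LaurentPolynomial.C t * (LaurentPolynomial.C t + 1) *
    substLeft t f * substRight t g) * hT

/-- Both sides obey the same recursion. On the boundary only one substitution occurs; it involves
powers of y of one sign only, so its constant coefficient is a power of t. -/
theorem aeval_diamondMonomial (i j : ℕ) : aeval t (diamondMonomial i j) =
    (substLeft t (X ^ i) * substRight t (X ^ j)).coeff 0 := by
  have hp : ∀ (c : ℂ) i, (Polynomial.toLaurent ((C t + C c * X) ^ i)).coeff 0 = t ^ i := by
    intro c i
    have := coeff_toLaurent_natCast ((C t + C c * X) ^ i) 0
    rw [Nat.cast_zero] at this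
    rw [this, coeff_zero_eq_eval_zero]
    simp
  have hl : ∀ i, (substLeft t (X ^ i)).coeff 0 = t ^ i := by
    intro i
    rw [← hp 1 i]
    simp [substLeft_X]
  have hr : ∀ i, (substRight t (X ^ i)).coeff 0 = t ^ i := by
    intro i
    have : substRight t (X ^ i) = LaurentPolynomial.invert
        (Polynomial.toLaurent ((C t + C (t * (t + 1)) * X) ^ i)) := by
      simp [substRight_X]
    rw [this, LaurentPolynomial.invert_apply, neg_zero, hp]
  induction i, j using diamondMonomial.induct with
  | case1 j => rw [diamondMonomial, pow_zero, map_one, one_mul, hr, map_pow, aeval_X]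
  | case2 i => rw [diamondMonomial, pow_zero, map_one, mul_one, hl, map_pow, aeval_X]
  | case3 i j h1 h2 h3 =>
    rw [diamondMonomial, map_mul, map_add, map_add, h1, h2, h3, aeval_X]
    rw [pow_succ' X i, pow_succ' X j, subst_recursion, coeff_C_mul]
    simp

theorem aeval_diamond (f g : ℝ[X]) :
    aeval t (diamond f g) = (substLeft t f * substRight t g).coeff 0 := by
  conv_rhs => rw [f.as_sum_support_C_mul_X_pow, g.as_sum_support_C_mul_X_pow]
  simp only [diamond, Polynomial.sum, map_sum, Finset.sum_mul_sum, AddMonoidAlgebra.coeff_sum,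
    Finsupp.coe_finsetSum, Finset.sum_apply]
  refine Finset.sum_congr rfl fun i _ => Finset.sum_congr rfl fun j _ => ?_
  rw [map_mul, aeval_C, aeval_diamondMonomial, map_mul (substLeft t), map_mul (substRight t),
    substLeft_C, substRight_C,
    mul_mul_mul_comm, ← map_mul, coeff_C_mul]
  simp

end Evaluation

/-! ### Zeros in [-1, 0] and properness under the diamond product -/

/-- All complex zeros of `f` lie in the real interval `[-1, 0]`. -/
def RootsInUnit (f : ℝ[X]) : Prop :=
  ∀ t : ℂ, aeval t f = 0 → t.im = 0 ∧ t.re ∈ Set.Icc (-1 : ℝ) 0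

theorem RootsInUnit.splits {f : ℝ[X]} (h : RootsInUnit f) : f.Splits :=
  splits_of_aeval_ne_zero fun t ht h0 => ht.ne' (h t h0).1

theorem RootsInUnit.of_mem_roots {f : ℝ[X]} (h : RootsInUnit f) {a : ℝ} (ha : a ∈ f.roots) :
    a ∈ Set.Icc (-1 : ℝ) 0 := by
  have h0 : aeval (a : ℂ) f = 0 := by
    have : f.eval a = 0 := isRoot_of_mem_roots ha
    rw [← Complex.coe_algebraMap, aeval_algebraMap_apply_eq_algebraMap_eval, this, map_zero]
  simpa using (h _ h0).2

theorem RootsInUnit.of_dvd {f q : ℝ[X]} (h : RootsInUnit f) (hq : q ∣ f) : RootsInUnit q := by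
  obtain ⟨r, rfl⟩ := hq
  intro t ht
  exact h t (by rw [map_mul, ht, zero_mul])

/-- The half-plane `{z | 0 < (u * z).re}` contains `t - a` and `t * (t + 1) / (t - a)` for all
`a ∈ [-1, 0]`. -/
def IsDirection (t u : ℂ) : Prop :=
  ∀ a ∈ Set.Icc (-1 : ℝ) 0, 0 < (u * (t - a)).re ∧ 0 < (u * (t * (t + 1) / (t - a))).re

/-- Since t(t + 1)/(t - a) = t + a + 1 + a(a + 1)/(t - a), its imaginary part is Im t · (1 - a(a +
1)/|t - a|²). This is positive because a(a + 1) ≤ 0 on [-1, 0]. -/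
theorem isDirection_of_im_pos {t : ℂ} (ht : 0 < t.im) : IsDirection t (-Complex.I) := by
  intro a ha
  constructor
  · simpa using ht
  · have h0 : t - a ≠ 0 := by
      intro h
      have := congrArg Complex.im h
      simp at this
      exact ht.ne' this
    have hn := Complex.normSq_pos.mpr h0
    have e : (-Complex.I * (t * (t + 1) / (t - a))).re =
        t.im * ((t.re - a) ^ 2 + t.im ^ 2 + (-a) * (1 + a)) / Complex.normSq (t - a) := by
      rw [← mul_div_assoc, Complex.div_re, ← add_div]
      congr 1
      simp
      ring
    rw [e]
    have h1 : 0 ≤ (-a) * (1 + a) := mul_nonneg (by linarith [ha.2]) (by linarith [ha.1])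
    positivity

theorem isDirection_of_pos {x : ℝ} (hx : 0 < x) : IsDirection (x : ℂ) 1 := by
  intro a ha
  have h1 : 0 < x - a := by linarith [ha.2]
  have h2 : 0 < x * (x + 1) / (x - a) := by positivity
  rw [one_mul, one_mul]
  constructor <;> norm_cast

theorem isDirection_of_lt {x : ℝ} (hx : x < -1) : IsDirection (x : ℂ) (-1) := by
  intro a ha
  have h1 : x - a < 0 := by linarith [ha.1]
  have h2 : x * (x + 1) / (x - a) < 0 :=
    div_neg_of_pos_of_neg (mul_pos_of_neg_of_neg (by linarith) (by linarith)) h1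
  rw [neg_one_mul, neg_one_mul, Complex.neg_re, Complex.neg_re, neg_pos, neg_pos]
  constructor <;> norm_cast

/-- The polynomial whose coefficients are those of `substLeft t f * substRight t g`, where
`A` and `B` are the zeros of the monic polynomials `f` and `g`. -/
noncomputable def substPoly (t : ℂ) (A B : Multiset ℝ) : ℂ[X] :=
  (A.map fun a : ℝ => X + C (t - a)).prod *
    (B.map fun b : ℝ => C (t - b) * X + C (t * (t + 1))).prod

theorem toLaurent_substPoly (t : ℂ) (A B : Multiset ℝ) :
    Polynomial.toLaurent (substPoly t A B) = LaurentPolynomial.T (Multiset.card B) *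
      (substLeft t (A.map fun a => X - C a).prod * substRight t (B.map fun b => X - C b).prod) := by
  have hA : Polynomial.toLaurent (A.map fun a : ℝ => X + C (t - a)).prod =
      substLeft t (A.map fun a => X - C a).prod := by
    induction A using Multiset.induction_on with
    | empty => simp
    | cons a A ih =>
      rw [Multiset.map_cons, Multiset.prod_cons, map_mul, ih, Multiset.map_cons,
        Multiset.prod_cons, map_mul (substLeft t), map_sub (substLeft t), substLeft_X, substLeft_C]
      simp only [map_add, map_sub, toLaurent_X, toLaurent_C]
      ring
  have hB : Polynomial.toLaurent (B.map fun b : ℝ => C (t - b) * X + C (t * (t + 1))).prod =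
      LaurentPolynomial.T (Multiset.card B) * substRight t (B.map fun b => X - C b).prod := by
    induction B using Multiset.induction_on with
    | empty => simp
    | cons b B ih =>
      have hT : (LaurentPolynomial.T 1 * LaurentPolynomial.T (-1) : ℂ[T;T⁻¹]) = 1 := by
        rw [← LaurentPolynomial.T_add]; simp
      rw [Multiset.map_cons, Multiset.prod_cons, map_mul, ih, Multiset.map_cons,
        Multiset.prod_cons, map_mul (substRight t), map_sub (substRight t), substRight_X, substRight_C,
        Multiset.card_cons, Nat.cast_succ, LaurentPolynomial.T_add]
      simp only [map_add, map_mul, map_sub, toLaurent_C, toLaurent_X]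
      linear_combination (-LaurentPolynomial.C t * (LaurentPolynomial.C t +
        LaurentPolynomial.C 1) * LaurentPolynomial.T (Multiset.card B) *
        substRight t (B.map fun b => X - C b).prod) * hT
  rw [substPoly, map_mul, hA, hB]
  ring

/-- The factor y^(card B) clears the poles, so the constant coefficient sits at index `card B`,
within the degree range given by `natDegree_substPoly`. -/
theorem coeff_substPoly (t : ℂ) (A B : Multiset ℝ) (n : ℤ) (k : ℕ)
    (hk : (k : ℤ) = n + Multiset.card B) :
    (substLeft t (A.map fun a => X - C a).prod *
      substRight t (B.map fun b => X - C b).prod).coeff n = (substPoly t A B).coeff k := by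
  rw [← coeff_toLaurent_natCast, toLaurent_substPoly, coeff_T_mul, hk, add_sub_cancel_right]

theorem re_mul_neg_of_isRoot_substPoly {t u : ℂ} (hu : IsDirection t u) {A B : Multiset ℝ}
    (hA : ∀ a ∈ A, a ∈ Set.Icc (-1 : ℝ) 0) (hB : ∀ b ∈ B, b ∈ Set.Icc (-1 : ℝ) 0) {r : ℂ}
    (hr : (substPoly t A B).IsRoot r) : (u * r).re < 0 := by
  rw [substPoly, IsRoot, eval_mul, mul_eq_zero, eval_multiset_prod, eval_multiset_prod,
    Multiset.prod_eq_zero_iff, Multiset.prod_eq_zero_iff] at hr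
  simp only [Multiset.map_map, Multiset.mem_map, Function.comp_apply, eval_add, eval_X, eval_C,
    eval_mul] at hr
  rcases hr with ⟨a, ha, h⟩ | ⟨b, hb, h⟩
  · have h1 := (hu a (hA a ha)).1
    rw [eq_neg_of_add_eq_zero_left h, mul_neg, Complex.neg_re]
    linarith
  · have h1 := hu b (hB b hb)
    have h0 : t - b ≠ 0 := by
      intro h0
      simp [h0] at h1
    have : r = -(t * (t + 1) / (t - b)) := by
      field_simp
      linear_combination h
    rw [this, mul_neg, Complex.neg_re]
    linarith [h1.2]

theorem natDegree_substPoly {t u : ℂ} (hu : IsDirection t u) (A : Multiset ℝ) {B : Multiset ℝ}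
    (hB : ∀ b ∈ B, b ∈ Set.Icc (-1 : ℝ) 0) :
    (substPoly t A B).natDegree = Multiset.card A + Multiset.card B ∧ substPoly t A B ≠ 0 := by
  have hl : (A.map fun a : ℝ => X + C (t - a)).prod.Monic :=
    monic_multiset_prod_of_monic _ _ fun a _ => monic_X_add_C _
  have hlc : (A.map fun a : ℝ => X + C (t - a)).prod.natDegree = Multiset.card A := by
    rw [natDegree_multiset_prod_of_monic]
    · simp only [Multiset.map_map, Function.comp_def, natDegree_X_add_C]
      simp
    · intro f hf
      obtain ⟨a, _, rfl⟩ := Multiset.mem_map.mp hf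
      exact monic_X_add_C _
  have hne : ∀ b ∈ B, t - (b : ℂ) ≠ 0 := by
    intro b hb h0
    have := (hu b (hB b hb)).1
    simp [h0] at this
  have hr : (B.map fun b : ℝ => C (t - b) * X + C (t * (t + 1))).prod.natDegree =
      Multiset.card B ∧ (B.map fun b : ℝ => C (t - b) * X + C (t * (t + 1))).prod ≠ 0 := by
    have h0 : (0 : ℂ[X]) ∉ B.map fun b : ℝ => C (t - b) * X + C (t * (t + 1)) := by
      intro h
      obtain ⟨b, hb, h⟩ := Multiset.mem_map.mp h
      have := natDegree_linear (b := t * (t + 1)) (hne b hb)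
      rw [h] at this
      simp at this
    refine ⟨?_, fun h => h0 (Multiset.prod_eq_zero_iff.mp h)⟩
    rw [natDegree_multiset_prod _ h0, Multiset.map_map]
    exact (congrArg Multiset.sum (Multiset.map_congr rfl (g := fun _ => 1)
      fun b hb => natDegree_linear (hne b hb))).trans (by simp)
  rw [substPoly]
  exact ⟨by rw [natDegree_mul hl.ne_zero hr.2, hlc, hr.1], mul_ne_zero hl.ne_zero hr.2⟩

theorem diamond_C_mul_left (c : ℝ) (f g : ℝ[X]) : diamond (C c * f) g = C c * diamond f g := by
  refine eq_of_chooseEval_eq fun n => ?_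
  rw [chooseEval_diamond, ← smul_eq_C_mul, ← smul_eq_C_mul, map_smul, map_smul,
    chooseEval_diamond, smul_eq_mul, smul_eq_mul, mul_assoc]

theorem diamond_comm (f g : ℝ[X]) : diamond f g = diamond g f :=
  eq_of_chooseEval_eq fun n => by rw [chooseEval_diamond, chooseEval_diamond, mul_comm]

theorem diamond_C_mul_right (c : ℝ) (f g : ℝ[X]) : diamond f (C c * g) = C c * diamond f g := by
  rw [diamond_comm, diamond_C_mul_left, diamond_comm]

theorem diamond_add_left (f f' g : ℝ[X]) : diamond (f + f') g = diamond f g + diamond f' g :=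
  eq_of_chooseEval_eq fun n => by
    rw [chooseEval_diamond, map_add, map_add, chooseEval_diamond, chooseEval_diamond, add_mul]

theorem diamond_zero_left (g : ℝ[X]) : diamond 0 g = 0 := by simp [diamond]

theorem aeval_diamond_ne_zero_of_isDirection {f g : ℝ[X]} (hf : f ≠ 0) (hg : g ≠ 0)
    (hfr : RootsInUnit f) (hgr : RootsInUnit g) {t u : ℂ} (hu : IsDirection t u) :
    aeval t (diamond f g) ≠ 0 := by
  have hA : ∀ a ∈ f.roots, a ∈ Set.Icc (-1 : ℝ) 0 := fun a => hfr.of_mem_roots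
  have hB : ∀ a ∈ g.roots, a ∈ Set.Icc (-1 : ℝ) 0 := fun a => hgr.of_mem_roots
  obtain ⟨hd, h0⟩ := natDegree_substPoly hu f.roots hB
  have hc := (coeff_ne_zero_and_re_div_pos (Multiset.card g.roots) h0
    fun r => re_mul_neg_of_isRoot_substPoly hu hA hB).1 (by omega)
  rw [hfr.splits.eq_prod_roots, hgr.splits.eq_prod_roots, diamond_C_mul_left,
    diamond_C_mul_right, map_mul, map_mul, aeval_C, aeval_C, aeval_diamond,
    coeff_substPoly t _ _ 0 (Multiset.card g.roots) (by simp)]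
  refine mul_ne_zero ?_ (mul_ne_zero ?_ hc)
  · simpa using hf
  · simpa using hg

/-- Directions exist at every t with Im t > 0 and at every real t outside [-1, 0]; conjugation
covers Im t < 0. -/
theorem RootsInUnit.diamond {f g : ℝ[X]} (hf : f ≠ 0) (hg : g ≠ 0)
    (hfr : RootsInUnit f) (hgr : RootsInUnit g) : RootsInUnit (diamond f g) := by
  intro t ht
  have key := @aeval_diamond_ne_zero_of_isDirection f g hf hg hfr hgr
  have him : t.im = 0 := by
    rcases lt_trichotomy t.im 0 with hlt | heq | hgt
    · exact absurd (by rw [aeval_conj, ht, map_zero])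
        (key (isDirection_of_im_pos (t := starRingEnd ℂ t) (by simpa using hlt)))
    · exact heq
    · exact absurd ht (key (isDirection_of_im_pos hgt))
  have hre : t = (t.re : ℂ) := Complex.ext (by simp) (by simp [him])
  refine ⟨him, ?_, ?_⟩
  · by_contra! h
    rw [hre] at ht
    exact key (isDirection_of_lt h) ht
  · by_contra! h
    rw [hre] at ht
    exact key (isDirection_of_pos h) ht

theorem Proper.C_mul_iff {g f : ℝ[X]} {c : ℝ} (hc : 0 < c) : Proper g (C c * f) ↔ Proper g f := by
  refine forall₂_congr fun t _ => ?_
  rw [map_mul, aeval_C, mul_assoc, Complex.coe_algebraMap, Complex.im_ofReal_mul]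
  exact mul_nonneg_iff_of_pos_left hc

theorem Proper.C_mul_C_mul_iff {g f : ℝ[X]} {c : ℝ} (hc : c ≠ 0) :
    Proper (C c * g) (C c * f) ↔ Proper g f :=
  ⟨fun h => h.of_mul fun t _ => by simpa using hc, fun h => h.mul _⟩

/-- Let F be the Laurent polynomial of the pair (q, h). Multiplying q by X - α multiplies F by t - α
+ y, so the new constant coefficient is (t - α)F₀ + F₋₁. After division by F₀, the first term has
imaginary part Im t and the second is a quotient of consecutive coefficients, controlled by the
direction -i. -/
theorem proper_diamond_X_sub_C_mul {q h : ℝ[X]} (hqr : RootsInUnit q)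
    (hhr : RootsInUnit h) (hq : q ≠ 0) (hh : h ≠ 0) (α : ℝ) :
    Proper (diamond q h) (diamond ((X - C α) * q) h) := by
  rw [hqr.splits.eq_prod_roots, hhr.splits.eq_prod_roots, mul_left_comm, diamond_C_mul_left,
    diamond_C_mul_left, Proper.C_mul_C_mul_iff (by simpa using hq), diamond_C_mul_right,
    diamond_C_mul_right, Proper.C_mul_C_mul_iff (by simpa using hh)]
  intro t ht
  have hu := isDirection_of_im_pos ht
  have hA : ∀ a ∈ q.roots, a ∈ Set.Icc (-1 : ℝ) 0 := fun a => hqr.of_mem_roots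
  have hB : ∀ a ∈ h.roots, a ∈ Set.Icc (-1 : ℝ) 0 := fun a => hhr.of_mem_roots
  obtain ⟨hd, h0⟩ := natDegree_substPoly hu q.roots hB
  set F := substLeft t (q.roots.map fun a => X - C a).prod *
    substRight t (h.roots.map fun a => X - C a).prod with hF
  have e0 : F.coeff 0 = (substPoly t q.roots h.roots).coeff (Multiset.card h.roots) :=
    coeff_substPoly t _ _ 0 _ (by simp)
  have e1 : 0 ≤ (F.coeff (-1) * starRingEnd ℂ (F.coeff 0)).im := by
    -- If h is constant, F has no negative powers of y and F₋₁ = 0.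
    rcases hm : Multiset.card h.roots with _ | m
    · have : h.roots = 0 := Multiset.card_eq_zero.mp hm
      have h1 : F.coeff (-1) = 0 := by
        have h2 := toLaurent_substPoly t q.roots h.roots
        rw [← hF, hm, Nat.cast_zero, LaurentPolynomial.T_zero, one_mul] at h2
        rw [← h2, LaurentPolynomial.coeff_toLaurent]
        refine Finsupp.mapDomain_of_notMem_range _ _ ?_
        rintro ⟨k, hk⟩
        have : (k : ℤ) = -1 := hk
        omega
      simp [h1]
    · have e2 : F.coeff (-1) = (substPoly t q.roots h.roots).coeff m :=
        coeff_substPoly t _ _ (-1) _ (by rw [hm]; push_cast; ring)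
      have hc := coeff_ne_zero_and_re_div_pos m h0
        fun r => re_mul_neg_of_isRoot_substPoly hu hA hB
      have hpos := hc.2 (by omega)
      have hne := hc.1 (by omega)
      rw [e2, e0, hm]
      set c₀ := (substPoly t q.roots h.roots).coeff m
      set c₁ := (substPoly t q.roots h.roots).coeff (m + 1)
      have : (c₁ / (-Complex.I * c₀)).re =
          (c₀ * starRingEnd ℂ c₁).im / Complex.normSq (-Complex.I * c₀) := by
        rw [Complex.div_re, ← add_div]
        congr 1
        simp
        ring
      rw [this] at hpos
      exact ((div_pos_iff_of_pos_right (Complex.normSq_pos.mpr (by simpa using hne))).mp hpos).le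
  rw [aeval_diamond, aeval_diamond, map_mul (substLeft t), mul_assoc, ← hF,
    map_sub (substLeft t), substLeft_X, substLeft_C]
  have e3 : ((LaurentPolynomial.C t + LaurentPolynomial.T 1 - LaurentPolynomial.C (α : ℂ)) *
      F).coeff 0 = (t - α) * F.coeff 0 + F.coeff (-1) := by
    have : (LaurentPolynomial.C t + LaurentPolynomial.T 1 - LaurentPolynomial.C (α : ℂ)) * F =
        LaurentPolynomial.C (t - α) * F + LaurentPolynomial.T 1 * F := by
      rw [map_sub]; ring
    rw [this, AddMonoidAlgebra.coeff_add, Finsupp.add_apply, coeff_C_mul, coeff_T_mul, zero_sub]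
  rw [e3, add_mul, mul_assoc, Complex.mul_conj, Complex.add_im, Complex.im_mul_ofReal]
  refine add_nonneg (mul_nonneg ?_ (Complex.normSq_nonneg _)) e1
  simpa using ht.le

theorem Proper.add_left {g g' f : ℝ[X]} (h : Proper g f) (h' : Proper g' f) :
    Proper (g + g') f := by
  intro t ht
  rw [map_add, map_add, mul_add, Complex.add_im]
  exact add_nonneg (h t ht) (h' t ht)

/-- Properness is additive in its first argument and ◇ is bilinear, so the generators of the
deletion cone of f suffice. -/
theorem Proper.diamond {g f h : ℝ[X]} (hg : g ≠ 0) (hf : f ≠ 0) (hfr : RootsInUnit f)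
    (hh : h ≠ 0) (hhr : RootsInUnit h) (hd : f.natDegree = g.natDegree + 1) (hP : Proper g f) :
    Proper (diamond g h) (diamond f h) := by
  have hmem := hP.mem_deletionCone hg hf hfr.splits hd
  clear hP hd hg
  induction hmem using AddSubmonoid.closure_induction with
  | mem q hq =>
    obtain ⟨c, α, hc, hq⟩ := hq
    rcases hc.eq_or_lt with rfl | hc
    · rw [C_0, zero_mul] at hq
      have := (mul_eq_zero.mp hq).resolve_left (X_sub_C_ne_zero α)
      subst this
      intro t _
      simp [diamond_zero_left]
    · have hq0 : q ≠ 0 := by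
        rintro rfl
        rw [mul_zero] at hq
        exact mul_ne_zero (C_ne_zero.mpr hc.ne') hf hq.symm
      have hdvd : q ∣ f := by
        refine ⟨C c⁻¹ * (X - C α), ?_⟩
        have : C c⁻¹ * C c = (1 : ℝ[X]) := by rw [← C_mul, inv_mul_cancel₀ hc.ne', C_1]
        linear_combination C c⁻¹ * (-hq) - f * this
      have := proper_diamond_X_sub_C_mul (hfr.of_dvd hdvd) hhr hq0 hh α
      rwa [hq, diamond_C_mul_left, Proper.C_mul_iff hc] at this
  | zero =>
    intro t _
    simp [diamond_zero_left]
  | add x y _ _ hx hy =>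
    rw [diamond_add_left]
    exact hx.add_left hy

/-! ### Counting partitions and the E-polynomial of a combined poset -/

section Counting

/-- A function on `S = i(P) ⊔ j(Q)` as a pair of functions. -/
noncomputable def splitEquiv {P Q S : Type*} {i : P → S} {j : Q → S}
    (h : Function.Bijective (Sum.elim i j)) (n : ℕ) :
    (S → Fin n) ≃ (P → Fin n) × (Q → Fin n) :=
  ((Equiv.ofBijective _ h).symm.arrowCongr (Equiv.refl _)).trans
    (Equiv.sumArrowEquivProdArrow P Q (Fin n))

theorem splitEquiv_apply {P Q S : Type*} {i : P → S} {j : Q → S}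
    (h : Function.Bijective (Sum.elim i j)) {n : ℕ} (σ : S → Fin n) :
    splitEquiv h n σ = (σ ∘ i, σ ∘ j) := rfl

variable {P Q S : Type*} [PartialOrder P] [PartialOrder Q] [PartialOrder S]

/-- The number of all `(P, ω)`-partitions with values in `Fin n`. -/
noncomputable def partCount (ω : P ↪ ℕ) (n : ℕ) : ℕ := Nat.card {σ : P → Fin n // IsPartition ω σ}

theorem IsPartition.comp_strictMono {ω : P ↪ ℕ} {m n : ℕ} {σ : P → Fin m} {e : Fin m → Fin n}
    (he : StrictMono e) : IsPartition ω (e ∘ σ) ↔ IsPartition ω σ := by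
  constructor
  · intro h
    exact ⟨fun x y hxy => he.le_iff_le.mp (h.le_of_le x y hxy),
      fun x y hxy hω => he.lt_iff_lt.mp (h.lt_of_lt x y hxy hω)⟩
  · intro h
    exact ⟨fun x y hxy => he.monotone (h.le_of_le x y hxy),
      fun x y hxy hω => he (h.lt_of_lt x y hxy hω)⟩

theorem card_isPartition_range_eq (ω : P ↪ ℕ) {n : ℕ} (A : Finset (Fin n)) :
    Nat.card {σ : P → Fin n // IsPartition ω σ ∧ Set.range σ = A} = surjCount ω A.card := by
  let e := A.orderEmbOfFin rfl
  have hr : Set.range e = A := A.range_orderEmbOfFin rfl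
  symm
  refine Nat.card_congr (Equiv.ofBijective (fun σ => ⟨e ∘ σ.1, ?_, ?_⟩) ⟨?_, ?_⟩)
  · exact (IsPartition.comp_strictMono e.strictMono).mpr σ.2.1
  · rw [σ.2.2.range_comp, hr]
  · intro σ τ h
    refine Subtype.ext (funext fun x => e.injective ?_)
    exact congrFun (congrArg Subtype.val h) x
  · rintro ⟨τ, hτ, hA⟩
    have hmem : ∀ x, ∃ m, e m = τ x := fun x => by
      have : τ x ∈ Set.range e := by rw [hr, ← hA]; exact ⟨x, rfl⟩
      exact this
    choose σ hσ using hmem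
    have hcomp : e ∘ σ = τ := funext hσ
    refine ⟨⟨σ, ?_, fun m => ?_⟩, Subtype.ext hcomp⟩
    · rw [← IsPartition.comp_strictMono e.strictMono, hcomp]
      exact hτ
    · have : e m ∈ Set.range τ := by rw [hA, ← hr]; exact ⟨m, rfl⟩
      obtain ⟨x, hx⟩ := this
      exact ⟨x, e.injective (by rw [hσ, hx])⟩

theorem surjCount_eq_zero_of_lt [Finite P] (ω : P ↪ ℕ) {k : ℕ} (hk : Nat.card P < k) :
    surjCount ω k = 0 := by
  have : IsEmpty {σ : P → Fin k // IsPartition ω σ ∧ Function.Surjective σ} := by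
    refine ⟨fun σ => ?_⟩
    have := Nat.card_le_card_of_surjective σ.1 σ.2.2
    rw [Nat.card_fin] at this
    omega
  exact Nat.card_of_isEmpty

theorem surjCount_zero_eq_zero [Nonempty P] (ω : P ↪ ℕ) : surjCount ω 0 = 0 := by
  have : IsEmpty {σ : P → Fin 0 // IsPartition ω σ ∧ Function.Surjective σ} :=
    ⟨fun σ => (σ.1 (Classical.arbitrary P)).elim0⟩
  exact Nat.card_of_isEmpty

theorem coeff_ePoly [Finite P] (ω : P ↪ ℕ) (k : ℕ) : (ePoly ω).coeff k = surjCount ω k := by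
  rw [ePoly, finsetSum_coeff]
  simp only [coeff_C_mul_X_pow]
  rw [Finset.sum_ite_eq]
  split_ifs with h
  · rfl
  · rw [surjCount_eq_zero_of_lt ω (by simpa using h), Nat.cast_zero]

/-- A reversed linear extension is a bijective strictly order-reversing map, hence a partition for
every labelling. This makes the degree of E exactly |P|. -/
theorem surjCount_card_pos [Finite P] (ω : P ↪ ℕ) : 0 < surjCount ω (Nat.card P) := by
  classical
  have : Fintype (LinearExtension P) := Fintype.ofFinite P
  have hc : Fintype.card (LinearExtension P) = Nat.card P := Nat.card_eq_fintype_card.symm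
  let e := Fintype.orderIsoFinOfCardEq (LinearExtension P) hc
  let σ : P → Fin (Nat.card P) := fun x => Fin.rev (e.symm (toLinearExtension x))
  have hinj : Function.Injective (toLinearExtension : P → LinearExtension P) := fun _ _ h => h
  have hmono : ∀ x y : P, x ≤ y → σ y ≤ σ x := fun x y hxy =>
    Fin.rev_le_rev.mpr (e.symm.monotone (toLinearExtension.monotone hxy))
  have hσ : Function.Injective σ := fun x y h =>
    hinj (e.symm.injective (Fin.rev_injective h))
  have : Nonempty {σ : P → Fin (Nat.card P) // IsPartition ω σ ∧ Function.Surjective σ} := by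
    refine ⟨σ, ⟨hmono, fun x y hxy _ => ?_⟩, ?_⟩
    · exact lt_of_le_of_ne (hmono x y hxy.le) fun h => hxy.ne (hσ h).symm
    · exact (Nat.bijective_iff_injective_and_card σ).mpr ⟨hσ, by simp⟩ |>.2
  exact Nat.card_pos

theorem natDegree_ePoly [Finite P] (ω : P ↪ ℕ) : (ePoly ω).natDegree = Nat.card P := by
  refine natDegree_eq_of_le_of_coeff_ne_zero (natDegree_le_iff_coeff_eq_zero.mpr fun k hk => ?_) ?_
  · rw [coeff_ePoly, surjCount_eq_zero_of_lt ω hk, Nat.cast_zero]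
  · rw [coeff_ePoly]
    exact_mod_cast (surjCount_card_pos ω).ne'

theorem ePoly_ne_zero [Finite P] (ω : P ↪ ℕ) : ePoly ω ≠ 0 := by
  intro h
  have := coeff_ePoly ω (Nat.card P)
  rw [h, coeff_zero] at this
  exact (surjCount_card_pos ω).ne' (by exact_mod_cast this.symm)

theorem ePoly_of_isEmpty [IsEmpty P] (ω : P ↪ ℕ) : ePoly ω = 1 := by
  have h := surjCount_card_pos ω
  have h0 : Nat.card P = 0 := Nat.card_of_isEmpty
  have h1 : surjCount ω 0 ≤ 1 := Finite.card_le_one_iff_subsingleton.mpr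
    ⟨fun a b => Subtype.ext (funext fun x => isEmptyElim x)⟩
  rw [h0] at h
  have : surjCount ω 0 = 1 := by omega
  simp [ePoly, this]

theorem natDegree_ePoly_deleteLabel [Finite P] (ω : P ↪ ℕ) (x : P) :
    (ePoly ω).natDegree = (ePoly (deleteLabel ω x)).natDegree + 1 := by
  classical
  have : Fintype P := Fintype.ofFinite P
  rw [natDegree_ePoly, natDegree_ePoly, Nat.card_eq_fintype_card, Nat.card_eq_fintype_card]
  have h1 := Fintype.card_subtype_compl (fun y : P => y = x)
  have h2 : 0 < Fintype.card P := Fintype.card_pos_iff.mpr ⟨x⟩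
  rw [Fintype.card_subtype_eq] at h1
  have h3 : Fintype.card {y : P // y ≠ x} = Fintype.card {y : P // ¬ y = x} := rfl
  omega

theorem partCount_eq_sum [Finite P] (ω : P ↪ ℕ) (n : ℕ) :
    partCount ω n = ∑ A : Finset (Fin n), surjCount ω A.card := by
  classical
  have : Fintype P := Fintype.ofFinite P
  rw [partCount, Nat.card_eq_fintype_card, Fintype.card_subtype,
    Finset.card_eq_sum_card_fiberwise (f := fun σ : P → Fin n => Finset.univ.image σ)
      (t := Finset.univ) fun _ _ => Finset.mem_coe.mpr (Finset.mem_univ _)]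
  refine Finset.sum_congr rfl fun A _ => ?_
  rw [← card_isPartition_range_eq, Nat.card_eq_fintype_card, Fintype.card_subtype,
    Finset.filter_filter]
  congr 1
  ext σ
  simp only [Finset.mem_filter, Finset.mem_univ, true_and, ← Finset.coe_inj, Finset.coe_image,
    Finset.coe_univ, Set.image_univ]

/-- Partitions are sorted by their image: each of the choose n k images of size k accounts for
`surjCount ω k` of them. -/
theorem chooseEval_ePoly [Finite P] (ω : P ↪ ℕ) (n : ℕ) :
    chooseEval n (ePoly ω) = partCount ω n := by
  rw [partCount_eq_sum, ← Finset.powerset_univ, Finset.sum_powerset_apply_card,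
    Finset.card_univ, Fintype.card_fin, ePoly, map_sum]
  have h1 : ∀ k, chooseEval n (C (surjCount ω k : ℝ) * X ^ k) = n.choose k * surjCount ω k := by
    intro k
    rw [C_mul_X_pow_eq_monomial, chooseEval_monomial]
  simp only [h1]
  push_cast
  rw [Finset.sum_subset
    (Finset.range_mono (show Nat.card P + 1 ≤ Nat.card P + 1 + (n + 1) by omega)),
    Finset.sum_subset (Finset.range_mono (show n + 1 ≤ Nat.card P + 1 + (n + 1) by omega))]
  · simp
  · intro k _ hk
    rw [Finset.mem_range, not_lt] at hk
    simp [Nat.choose_eq_zero_of_lt (show n < k by omega)]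
  · intro k _ hk
    rw [Finset.mem_range, not_lt] at hk
    rw [surjCount_eq_zero_of_lt ω (by omega), Nat.cast_zero, mul_zero]

/-- The partitions of `S = i(P) ⊔ j(Q)` are the pairs of partitions of `P` and `Q` whose values are
related by `r`. -/
structure Combines (r : ℕ → ℕ → Prop) (ω : P ↪ ℕ) (ν : Q ↪ ℕ) (μ : S ↪ ℕ) (i : P → S)
    (j : Q → S) : Prop where
  bij : Function.Bijective (Sum.elim i j)
  isPartition_iff : ∀ {n : ℕ} (σ : S → Fin n), IsPartition μ σ ↔
    IsPartition ω (σ ∘ i) ∧ IsPartition ν (σ ∘ j) ∧ ∀ x y, r (σ (j y)) (σ (i x))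

variable {r : ℕ → ℕ → Prop} {ω : P ↪ ℕ} {ν : Q ↪ ℕ} {μ : S ↪ ℕ} {i : P → S} {j : Q → S}

theorem partCount_of_combines (h : Combines (fun _ _ => True) ω ν μ i j) (n : ℕ) :
    partCount μ n = partCount ω n * partCount ν n := by
  rw [partCount, partCount, partCount, ← Nat.card_prod]
  refine Nat.card_congr (((splitEquiv h.bij n).subtypeEquiv (q := fun p =>
    IsPartition ω p.1 ∧ IsPartition ν p.2) fun σ => ?_).trans Equiv.subtypeProdEquivProd)
  rw [h.isPartition_iff, splitEquiv_apply]
  simp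

theorem ePoly_of_combines_true [Finite P] [Finite Q] [Finite S]
    (h : Combines (fun _ _ => True) ω ν μ i j) : ePoly μ = diamond (ePoly ω) (ePoly ν) := by
  refine eq_of_chooseEval_eq fun n => ?_
  rw [chooseEval_diamond, chooseEval_ePoly, chooseEval_ePoly, chooseEval_ePoly,
    partCount_of_combines h, Nat.cast_mul]

open Classical in
/-- The pairs of value sets `(A, B)` that can occur for `Q` and `P` in a surjection onto `Fin k`. -/
noncomputable def valuePairs (r : ℕ → ℕ → Prop) (k : ℕ) :
    Finset (Finset (Fin k) × Finset (Fin k)) :=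
  Finset.univ.filter fun p => p.1 ∪ p.2 = Finset.univ ∧ ∀ b ∈ p.1, ∀ a ∈ p.2, r b a

theorem mem_valuePairs {k : ℕ} {p : Finset (Fin k) × Finset (Fin k)} : p ∈ valuePairs r k ↔
    (∀ v, v ∈ p.1 ∨ v ∈ p.2) ∧ ∀ b ∈ p.1, ∀ a ∈ p.2, r b a := by
  classical
  simp [valuePairs, Finset.ext_iff]

theorem surjCount_of_combines [Finite P] [Finite Q] [Finite S] (h : Combines r ω ν μ i j) (k : ℕ) :
    surjCount μ k = ∑ p ∈ valuePairs r k, surjCount ν p.1.card * surjCount ω p.2.card := by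
  classical
  have : Fintype P := Fintype.ofFinite P
  have : Fintype Q := Fintype.ofFinite Q
  have : Fintype S := Fintype.ofFinite S
  have hf : ∀ (σ : S → Fin k) (p : Finset (Fin k) × Finset (Fin k)),
      (Finset.univ.image (σ ∘ j), Finset.univ.image (σ ∘ i)) = p ↔
      Set.range (σ ∘ j) = p.1 ∧ Set.range (σ ∘ i) = p.2 := by
    intro σ p
    simp [Prod.ext_iff, ← Finset.coe_inj, Function.comp_def]
  rw [surjCount, Nat.card_eq_fintype_card, Fintype.card_subtype,
    Finset.card_eq_sum_card_fiberwise (t := valuePairs r k) (f := fun σ : S → Fin k =>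
      (Finset.univ.image (σ ∘ j), Finset.univ.image (σ ∘ i)))]
  · refine Finset.sum_congr rfl fun p hp => ?_
    rw [mem_valuePairs] at hp
    rw [← card_isPartition_range_eq, ← card_isPartition_range_eq, mul_comm, ← Nat.card_prod,
      Finset.filter_filter, ← Fintype.card_subtype, ← Nat.card_eq_fintype_card]
    refine Nat.card_congr (((splitEquiv h.bij k).subtypeEquiv (q := fun q =>
      (IsPartition ω q.1 ∧ Set.range q.1 = p.2) ∧ (IsPartition ν q.2 ∧ Set.range q.2 = p.1))
      fun σ => ?_).trans (Equiv.subtypeProdEquivProd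
        (p := fun τ : P → Fin k => IsPartition ω τ ∧ Set.range τ = p.2)
        (q := fun τ : Q → Fin k => IsPartition ν τ ∧ Set.range τ = p.1)))
    rw [h.isPartition_iff, splitEquiv_apply, hf]
    constructor
    · rintro ⟨⟨⟨h1, h2, _⟩, _⟩, h3, h4⟩
      exact ⟨⟨h1, h4⟩, h2, h3⟩
    · rintro ⟨⟨h1, h4⟩, h2, h3⟩
      refine ⟨⟨⟨h1, h2, fun x y => ?_⟩, fun v => ?_⟩, h3, h4⟩
      · refine hp.2 _ ?_ _ ?_
        · rw [← Finset.mem_coe, ← h3]; exact ⟨y, rfl⟩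
        · rw [← Finset.mem_coe, ← h4]; exact ⟨x, rfl⟩
      · rcases hp.1 v with hv | hv
        · rw [← Finset.mem_coe, ← h3] at hv
          obtain ⟨y, hy⟩ := hv
          exact ⟨_, hy⟩
        · rw [← Finset.mem_coe, ← h4] at hv
          obtain ⟨y, hy⟩ := hv
          exact ⟨_, hy⟩
  · intro σ hσ
    rw [Finset.coe_filter, Set.mem_ofPred_eq] at hσ
    obtain ⟨_, hσ, hs⟩ := hσ
    rw [h.isPartition_iff] at hσ
    rw [Finset.mem_coe, mem_valuePairs]
    constructor
    · intro v
      obtain ⟨s, rfl⟩ := hs v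
      obtain ⟨x | y, rfl⟩ := h.bij.2 s
      · exact Or.inr (Finset.mem_image.mpr ⟨x, Finset.mem_univ _, rfl⟩)
      · exact Or.inl (Finset.mem_image.mpr ⟨y, Finset.mem_univ _, rfl⟩)
    · intro b hb a ha
      obtain ⟨y, _, rfl⟩ := Finset.mem_image.mp hb
      obtain ⟨x, _, rfl⟩ := Finset.mem_image.mp ha
      exact hσ.2.2 x y

/-- The values below `c`. -/
def lowValues (k c : ℕ) : Finset (Fin k) := Finset.univ.filter fun v => (v : ℕ) < c

/-- The values at least `c`. -/
def highValues (k c : ℕ) : Finset (Fin k) := Finset.univ.filter fun v => c ≤ (v : ℕ)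

theorem card_lowValues {k c : ℕ} (hc : c ≤ k) : (lowValues k c).card = c := by
  have : (lowValues k c) = (Finset.univ : Finset (Fin c)).map (Fin.castLEEmb hc) := by
    ext v
    simp only [lowValues, Finset.mem_filter, Finset.mem_univ, true_and, Finset.mem_map]
    exact ⟨fun h => ⟨⟨v, h⟩, rfl⟩, by rintro ⟨a, rfl⟩; exact a.2⟩
  rw [this, Finset.card_map, Finset.card_univ, Fintype.card_fin]

theorem card_highValues {k c : ℕ} (hc : c ≤ k) : (highValues k c).card = k - c := by
  have h1 : highValues k c = (lowValues k c)ᶜ := by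
    ext v
    simp [lowValues, highValues]
  rw [h1, Finset.card_compl, card_lowValues hc, Fintype.card_fin]

theorem exists_eq_lowValues {k : ℕ} {A : Finset (Fin k)}
    (hA : ∀ v ∈ A, ∀ w, w < v → w ∈ A) : ∃ c ≤ k, A = lowValues k c := by
  classical
  have hex : ∃ c, ∀ v ∈ A, (v : ℕ) < c := ⟨k, fun v _ => v.2⟩
  refine ⟨Nat.find hex, Nat.find_min' hex fun v _ => v.2, ?_⟩
  ext v
  rw [lowValues, Finset.mem_filter]
  refine ⟨fun hv => ⟨Finset.mem_univ _, Nat.find_spec hex v hv⟩, fun ⟨_, hv⟩ => ?_⟩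
  have := Nat.find_min hex hv
  push Not at this
  obtain ⟨w, hw, hvw⟩ := this
  rcases (Fin.le_def.mpr hvw).eq_or_lt with rfl | hlt
  · exact hw
  · exact hA w hw v hlt

theorem exists_of_mem_valuePairs_lt {k : ℕ} {p : Finset (Fin k) × Finset (Fin k)}
    (hp : p ∈ valuePairs (· < ·) k) : ∃ c ≤ k, p = (lowValues k c, highValues k c) := by
  rw [mem_valuePairs] at hp
  obtain ⟨c, hc, h⟩ := exists_eq_lowValues (A := p.1) fun v hv w hw =>
    (hp.1 w).resolve_right fun hw' => absurd (hp.2 v hv w hw') (by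
      have := Fin.lt_def.mp hw; omega)
  refine ⟨c, hc, Prod.ext h ?_⟩
  ext v
  have h1 := hp.1 v
  have h2 : v ∈ p.1 ↔ (v : ℕ) < c := by rw [h]; simp [lowValues]
  have h3 : v ∈ highValues k c ↔ c ≤ (v : ℕ) := by simp [highValues]
  have h4 : v ∈ p.1 → v ∈ p.2 → False := fun ha hb => absurd (hp.2 v ha v hb) (lt_irrefl _)
  rw [h3, ← not_lt, ← h2]
  tauto

theorem sum_valuePairs_lt (F : ℕ → ℕ → ℕ) (k : ℕ) :
    ∑ p ∈ valuePairs (· < ·) k, F p.1.card p.2.card = ∑ c ∈ Finset.range (k + 1), F c (k - c) := by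
  refine Finset.sum_nbij' (fun p => p.1.card) (fun c => (lowValues k c, highValues k c))
    ?_ ?_ ?_ ?_ ?_
  · intro p _
    rw [Finset.mem_range]
    exact Nat.lt_succ_of_le (card_finset_fin_le _)
  · intro c _
    rw [mem_valuePairs]
    simp only [lowValues, highValues, Finset.mem_filter, Finset.mem_univ, true_and]
    exact ⟨fun v => lt_or_ge _ _, fun b hb a ha => lt_of_lt_of_le hb ha⟩
  · intro p hp
    obtain ⟨c, hc, rfl⟩ := exists_of_mem_valuePairs_lt hp
    simp [card_lowValues hc]
  · intro c hc
    exact card_lowValues (Finset.mem_range_succ_iff.mp hc)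
  · intro p hp
    obtain ⟨c, hc, rfl⟩ := exists_of_mem_valuePairs_lt hp
    simp [card_lowValues hc, card_highValues hc]

theorem exists_of_mem_valuePairs_le {k : ℕ} {p : Finset (Fin k) × Finset (Fin k)}
    (hp : p ∈ valuePairs (· ≤ ·) k) (hp' : p ∉ valuePairs (· < ·) k) :
    ∃ c < k, p = (lowValues k (c + 1), highValues k c) := by
  rw [mem_valuePairs] at hp hp'
  have : ∃ b ∈ p.1, ∃ a ∈ p.2, ¬ (b : ℕ) < a := by
    by_contra! h
    exact hp' ⟨hp.1, h⟩
  obtain ⟨b, hb, a, ha, hba⟩ := this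
  have hab : b = a := Fin.ext (le_antisymm (hp.2 b hb a ha) (not_lt.mp hba))
  subst hab
  refine ⟨b, b.2, Prod.ext ?_ ?_⟩
  · ext v
    have h3 : v ∈ lowValues k (b + 1) ↔ (v : ℕ) < b + 1 := by simp [lowValues]
    rw [h3, Nat.lt_succ_iff]
    refine ⟨fun hv => hp.2 v hv b ha, fun hv => ?_⟩
    rcases hv.eq_or_lt with h | h
    · rwa [Fin.ext h]
    · exact (hp.1 v).resolve_right fun hv' => absurd (hp.2 b hb v hv') (not_le.mpr h)
  · ext v
    have h3 : v ∈ highValues k b ↔ (b : ℕ) ≤ v := by simp [highValues]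
    rw [h3]
    refine ⟨fun hv => hp.2 b hb v hv, fun hv => ?_⟩
    rcases hv.eq_or_lt with h | h
    · rwa [← Fin.ext h]
    · exact (hp.1 v).resolve_left fun hv' => absurd (hp.2 v hv' b ha) (not_le.mpr h)

/-- The values on Q lie weakly below those on P, and together they cover the chain. Either the two
value sets are disjoint, split at a cut, or they share exactly one value c; then the lower one has c
+ 1 elements and the sizes add up to k + 1. -/
theorem sum_valuePairs_le (F : ℕ → ℕ → ℕ) (k : ℕ) :
    ∑ p ∈ valuePairs (· ≤ ·) k, F p.1.card p.2.card =
      ∑ c ∈ Finset.range (k + 1), F c (k - c) + ∑ c ∈ Finset.range k, F (c + 1) (k - c) := by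
  classical
  have hsub : valuePairs (· < ·) k ⊆ valuePairs (· ≤ ·) k := by
    intro p hp
    rw [mem_valuePairs] at hp ⊢
    exact ⟨hp.1, fun b hb a ha => (hp.2 b hb a ha).le⟩
  rw [← Finset.sum_sdiff hsub, add_comm, sum_valuePairs_lt]
  congr 1
  refine Finset.sum_nbij' (fun p => p.1.card - 1)
    (fun c => (lowValues k (c + 1), highValues k c)) ?_ ?_ ?_ ?_ ?_
  · intro p hp
    rw [Finset.mem_sdiff] at hp
    obtain ⟨c, hc, rfl⟩ := exists_of_mem_valuePairs_le hp.1 hp.2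
    simpa [card_lowValues (show c + 1 ≤ k from hc)] using hc
  · intro c hc
    rw [Finset.mem_range] at hc
    rw [Finset.mem_sdiff, mem_valuePairs, mem_valuePairs]
    simp only [lowValues, highValues, Finset.mem_filter, Finset.mem_univ, true_and]
    refine ⟨⟨fun v => by omega, fun b hb a ha => by omega⟩, fun h => ?_⟩
    exact absurd (h.2 ⟨c, hc⟩ (Nat.lt_succ_self c) ⟨c, hc⟩ le_rfl) (lt_irrefl _)
  · intro p hp
    rw [Finset.mem_sdiff] at hp
    obtain ⟨c, hc, rfl⟩ := exists_of_mem_valuePairs_le hp.1 hp.2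
    simp [card_lowValues (show c + 1 ≤ k from hc)]
  · intro c hc
    rw [Finset.mem_range] at hc
    simp [card_lowValues (show c + 1 ≤ k from hc)]
  · intro p hp
    rw [Finset.mem_sdiff] at hp
    obtain ⟨c, hc, rfl⟩ := exists_of_mem_valuePairs_le hp.1 hp.2
    simp [card_lowValues (show c + 1 ≤ k from hc), card_highValues hc.le]

theorem coeff_ePoly_mul [Finite P] [Finite Q] (ω : P ↪ ℕ) (ν : Q ↪ ℕ) (k : ℕ) :
    (ePoly ω * ePoly ν).coeff k =
      ((∑ c ∈ Finset.range (k + 1), surjCount ν c * surjCount ω (k - c) : ℕ) : ℝ) := by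
  rw [mul_comm, coeff_mul, Finset.Nat.sum_antidiagonal_eq_sum_range_succ_mk]
  simp [coeff_ePoly]

theorem ePoly_of_combines_lt [Finite P] [Finite Q] [Finite S] (h : Combines (· < ·) ω ν μ i j) :
    ePoly μ = ePoly ω * ePoly ν := by
  ext k
  rw [coeff_ePoly, coeff_ePoly_mul, surjCount_of_combines h,
    sum_valuePairs_lt fun a b => surjCount ν a * surjCount ω b]

/-- The shared-value sum is the coefficient of X^(k+1) in the product without its two end terms.
These vanish because E has no constant term on a nonempty poset; if P or Q is empty the identity
fails. -/
theorem X_mul_ePoly_of_combines_le [Finite P] [Finite Q] [Finite S] [Nonempty P] [Nonempty Q]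
    (h : Combines (· ≤ ·) ω ν μ i j) : X * ePoly μ = (X + 1) * (ePoly ω * ePoly ν) := by
  ext k
  rw [add_mul, one_mul, coeff_add]
  rcases k with _ | k
  · simp [coeff_ePoly, surjCount_zero_eq_zero]
  · rw [coeff_X_mul, coeff_X_mul, coeff_ePoly, coeff_ePoly_mul, coeff_ePoly_mul,
      surjCount_of_combines h, sum_valuePairs_le fun a b => surjCount ν a * surjCount ω b,
      Nat.cast_add, add_right_inj, Finset.sum_range_succ', Finset.sum_range_succ _ k]
    simp [surjCount_zero_eq_zero]

end Counting

/-! ### Deleting a point from a glued poset -/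

section Gluing

variable {P Q S : Type*} [PartialOrder P] [PartialOrder Q] [PartialOrder S]

/-- `S` is the disjoint union of the images of `P` and `Q`, with compatible orders and labels. -/
structure IsGlued (ω : P ↪ ℕ) (ν : Q ↪ ℕ) (μ : S ↪ ℕ) (i : P → S) (j : Q → S) : Prop where
  bij : Function.Bijective (Sum.elim i j)
  left_le : ∀ x y, i x ≤ i y ↔ x ≤ y
  right_le : ∀ x y, j x ≤ j y ↔ x ≤ y
  left_label : ∀ x y, μ (i x) < μ (i y) ↔ ω x < ω y
  right_label : ∀ x y, μ (j x) < μ (j y) ↔ ν x < ν y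

variable {ω : P ↪ ℕ} {ν : Q ↪ ℕ} {μ : S ↪ ℕ} {i : P → S} {j : Q → S}

theorem label_lt_iff_of_imp {P : Type*} {ω : P ↪ ℕ} {κ : P → ℕ}
    (h : ∀ x y, ω x < ω y → κ x < κ y) (x y : P) : κ x < κ y ↔ ω x < ω y := by
  refine ⟨fun hlt => ?_, h x y⟩
  rcases lt_trichotomy (ω x) (ω y) with h' | h' | h'
  · exact h'
  · rw [ω.injective h'] at hlt
    exact absurd hlt (lt_irrefl _)
  · exact absurd (h y x h') hlt.asymm

theorem IsGlued.symm (h : IsGlued ω ν μ i j) : IsGlued ν ω μ j i where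
  bij := by
    have : Sum.elim j i = Sum.elim i j ∘ Sum.swap := by
      ext (x | x) <;> rfl
    rw [this]
    exact h.bij.comp (Equiv.sumComm Q P).bijective
  left_le := h.right_le
  right_le := h.left_le
  left_label := h.right_label
  right_label := h.left_label

theorem IsGlued.left_injective (h : IsGlued ω ν μ i j) : Function.Injective i :=
  fun _ _ hxy => Sum.inl_injective (h.bij.1 hxy)

theorem IsGlued.left_ne_right (h : IsGlued ω ν μ i j) (x : P) (y : Q) : i x ≠ j y :=
  fun hxy => Sum.inl_ne_inr (h.bij.1 (a₁ := Sum.inl x) (a₂ := Sum.inr y) hxy)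

/-- Deleting a point of the left part. -/
theorem IsGlued.delete (h : IsGlued ω ν μ i j) (x : P) :
    ∃ (i' : {y : P // y ≠ x} → {s : S // s ≠ i x}) (j' : Q → {s : S // s ≠ i x}),
      (∀ y, (i' y : S) = i y) ∧ (∀ y, (j' y : S) = j y) ∧
      IsGlued (deleteLabel ω x) ν (deleteLabel μ (i x)) i' j' := by
  refine ⟨fun y => ⟨i y, fun e => y.2 (h.left_injective e)⟩,
    fun y => ⟨j y, fun e => h.left_ne_right x y e.symm⟩, fun _ => rfl, fun _ => rfl, ?_⟩
  refine ⟨⟨?_, ?_⟩, fun y z => h.left_le y z, h.right_le, fun y z => h.left_label y z,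
    h.right_label⟩
  · rintro (a | a) (b | b) hab
    · exact congrArg _ (Subtype.ext (h.left_injective (congrArg Subtype.val hab)))
    · exact absurd (congrArg Subtype.val hab) (h.left_ne_right _ _)
    · exact absurd (congrArg Subtype.val hab).symm (h.left_ne_right _ _)
    · exact congrArg _ (h.symm.left_injective (congrArg Subtype.val hab))
  · rintro ⟨s, hs⟩
    obtain ⟨y | y, rfl⟩ := h.bij.2 s
    · exact ⟨Sum.inl ⟨y, fun e => hs (congrArg i e)⟩, rfl⟩
    · exact ⟨Sum.inr y, rfl⟩

/-- Conditions inside P or inside Q are inherited; only those between a point of P and a point of Q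
depend on the kind of sum, and `r` condenses them. -/
theorem IsGlued.combines {r : ℕ → ℕ → Prop} (h : IsGlued ω ν μ i j)
    (hr : ∀ (x : P) (y : Q) (n : ℕ) (σ : S → Fin n),
      ((i x ≤ j y → σ (j y) ≤ σ (i x)) ∧ (j y ≤ i x → σ (i x) ≤ σ (j y)) ∧
        (i x < j y → μ (j y) < μ (i x) → σ (j y) < σ (i x)) ∧
        (j y < i x → μ (i x) < μ (j y) → σ (i x) < σ (j y))) ↔ r (σ (j y)) (σ (i x))) :
    Combines r ω ν μ i j := by
  have hl : ∀ x y, i x < i y ↔ x < y := fun x y =>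
    lt_iff_lt_of_le_iff_le' (h.left_le y x) (h.left_le x y)
  have hj : ∀ x y, j x < j y ↔ x < y := fun x y =>
    lt_iff_lt_of_le_iff_le' (h.right_le y x) (h.right_le x y)
  refine ⟨h.bij, fun σ => ⟨fun hσ => ⟨⟨?_, ?_⟩, ⟨?_, ?_⟩, fun x y => (hr x y _ σ).mp ?_⟩, ?_⟩⟩
  · exact fun x y hxy => hσ.le_of_le _ _ ((h.left_le x y).mpr hxy)
  · exact fun x y hxy hω => hσ.lt_of_lt _ _ ((hl x y).mpr hxy) ((h.left_label y x).mpr hω)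
  · exact fun x y hxy => hσ.le_of_le _ _ ((h.right_le x y).mpr hxy)
  · exact fun x y hxy hω => hσ.lt_of_lt _ _ ((hj x y).mpr hxy) ((h.right_label y x).mpr hω)
  · exact ⟨hσ.le_of_le _ _, hσ.le_of_le _ _, hσ.lt_of_lt _ _, hσ.lt_of_lt _ _⟩
  · rintro ⟨h1, h2, h3⟩
    have h3' := fun x y => (hr x y _ σ).mpr (h3 x y)
    constructor
    · intro s t hst
      obtain ⟨x | x, rfl⟩ := h.bij.2 s <;> obtain ⟨y | y, rfl⟩ := h.bij.2 t
      · exact h1.le_of_le x y ((h.left_le x y).mp hst)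
      · exact (h3' x y).1 hst
      · exact (h3' y x).2.1 hst
      · exact h2.le_of_le x y ((h.right_le x y).mp hst)
    · intro s t hst hμ
      obtain ⟨x | x, rfl⟩ := h.bij.2 s <;> obtain ⟨y | y, rfl⟩ := h.bij.2 t
      · exact h1.lt_of_lt x y ((hl x y).mp hst) ((h.left_label y x).mp hμ)
      · exact (h3' x y).2.2.1 hst hμ
      · exact (h3' y x).2.2.2 hst hμ
      · exact h2.lt_of_lt x y ((hj x y).mp hst) ((h.right_label y x).mp hμ)

theorem IsGlued.combines_lt (h : IsGlued ω ν μ i j)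
    (hc : ∀ x y, i x < j y ∧ μ (j y) < μ (i x)) : Combines (· < ·) ω ν μ i j := by
  refine h.combines fun x y n σ => ?_
  obtain ⟨h1, h2⟩ := hc x y
  rw [← Fin.lt_def]
  exact ⟨fun H => H.2.2.1 h1 h2, fun H => ⟨fun _ => H.le, fun h' => absurd h' h1.not_ge,
    fun _ _ => H, fun h' => absurd h' h1.asymm⟩⟩

theorem IsGlued.combines_le (h : IsGlued ω ν μ i j)
    (hc : ∀ x y, i x < j y ∧ μ (i x) < μ (j y)) : Combines (· ≤ ·) ω ν μ i j := by
  refine h.combines fun x y n σ => ?_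
  obtain ⟨h1, h2⟩ := hc x y
  rw [← Fin.le_def]
  exact ⟨fun H => H.1 h1.le, fun H => ⟨fun _ => H, fun h' => absurd h' h1.not_ge,
    fun _ h' => absurd h' h2.asymm, fun h' => absurd h' h1.asymm⟩⟩

theorem IsGlued.combines_true (h : IsGlued ω ν μ i j)
    (hc : ∀ x y, ¬ i x ≤ j y ∧ ¬ j y ≤ i x) : Combines (fun _ _ => True) ω ν μ i j := by
  refine h.combines fun x y n σ => ?_
  obtain ⟨h1, h2⟩ := hc x y
  exact ⟨fun _ => trivial, fun _ => ⟨fun h' => absurd h' h1, fun h' => absurd h' h2,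
    fun h' => absurd h'.le h1, fun h' => absurd h'.le h2⟩⟩

/-- The zeros of `E(S)` lie in `[-1, 0]` and `E(S ∖ x)` is proper with respect to `E(S)`. -/
structure IsDeletionProper (μ : S ↪ ℕ) : Prop where
  roots : RootsInUnit (ePoly μ)
  proper : ∀ x, Proper (ePoly (deleteLabel μ x)) (ePoly μ)

theorem RootsInUnit.mul {f g : ℝ[X]} (hf : RootsInUnit f) (hg : RootsInUnit g) :
    RootsInUnit (f * g) := by
  intro t ht
  rw [map_mul, mul_eq_zero] at ht
  exact ht.elim (hf t) (hg t)

theorem IsGlued.isDeletionProper_of_lt [Finite P] [Finite Q] [Finite S] (h : IsGlued ω ν μ i j)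
    (hc : ∀ x y, i x < j y ∧ μ (j y) < μ (i x))
    (hω : IsDeletionProper ω) (hν : IsDeletionProper ν) : IsDeletionProper μ := by
  have e := ePoly_of_combines_lt (h.combines_lt hc)
  refine ⟨e ▸ hω.roots.mul hν.roots, fun s => ?_⟩
  obtain ⟨x | y, rfl⟩ := h.bij.2 s
  · obtain ⟨i', j', hi, hj, h'⟩ := h.delete x
    have e' := ePoly_of_combines_lt (h'.combines_lt fun a b => by
      have := hc a b
      rw [← hi, ← hj] at this
      exact this)
    change Proper (ePoly (deleteLabel μ (i x))) _
    rw [e, e', mul_comm, mul_comm (ePoly ω)]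
    exact (hω.proper x).mul _
  · obtain ⟨j', i', hj, hi, h'⟩ := h.symm.delete y
    have e' := ePoly_of_combines_lt (h'.symm.combines_lt fun a b => by
      have := hc a b
      rw [← hi, ← hj] at this
      exact this)
    change Proper (ePoly (deleteLabel μ (j y))) _
    rw [e, e']
    exact (hν.proper y).mul _

theorem IsGlued.isDeletionProper_of_true [Finite P] [Finite Q] [Finite S] (h : IsGlued ω ν μ i j)
    (hc : ∀ x y, ¬ i x ≤ j y ∧ ¬ j y ≤ i x)
    (hω : IsDeletionProper ω) (hν : IsDeletionProper ν) : IsDeletionProper μ := by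
  have e := ePoly_of_combines_true (h.combines_true hc)
  refine ⟨e ▸ hω.roots.diamond (ePoly_ne_zero ω) (ePoly_ne_zero ν) hν.roots, fun s => ?_⟩
  obtain ⟨x | y, rfl⟩ := h.bij.2 s
  · obtain ⟨i', j', hi, hj, h'⟩ := h.delete x
    have e' := ePoly_of_combines_true (h'.combines_true fun a b => by
      have := hc a b
      rw [← hi, ← hj] at this
      exact this)
    change Proper (ePoly (deleteLabel μ (i x))) _
    rw [e, e']
    exact (hω.proper x).diamond (ePoly_ne_zero _) (ePoly_ne_zero _) hω.roots (ePoly_ne_zero _)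
      hν.roots (natDegree_ePoly_deleteLabel ω x)
  · obtain ⟨j', i', hj, hi, h'⟩ := h.symm.delete y
    have e' := ePoly_of_combines_true (h'.symm.combines_true fun a b => by
      have := hc a b
      rw [← hi, ← hj] at this
      exact this)
    change Proper (ePoly (deleteLabel μ (j y))) _
    rw [e, e', diamond_comm, diamond_comm (ePoly ω)]
    exact (hν.proper y).diamond (ePoly_ne_zero _) (ePoly_ne_zero _) hν.roots (ePoly_ne_zero _)
      hω.roots (natDegree_ePoly_deleteLabel ν y)

theorem ePoly_of_unique [Unique P] (ω : P ↪ ℕ) : ∃ c : ℝ, 0 < c ∧ ePoly ω = C c * X := by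
  have hcard : Nat.card P = 1 := Nat.card_unique
  have hd : (ePoly ω).natDegree ≤ 1 := by rw [natDegree_ePoly, hcard]
  refine ⟨(ePoly ω).coeff 1, ?_, ?_⟩
  · have := surjCount_card_pos ω
    rw [hcard] at this
    rw [coeff_ePoly]
    exact_mod_cast this
  · conv_lhs => rw [eq_X_add_C_of_natDegree_le_one hd]
    rw [coeff_ePoly ω 0, surjCount_zero_eq_zero]
    simp

/-- Here b is E of the other summand. If points remain beside x, both sides carry the common factor
(X + 1)b. If x was the only point, then E(P) = cX, so F = c(X + 1)b and F' = b, and properness reads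
Im(c(t + 1)) ≥ 0. -/
theorem proper_of_X_mul_eq [Finite P] {x : P} {b F F' : ℝ[X]}
    (hF : X * F = (X + 1) * (ePoly ω * b))
    (hF' : Nonempty {y : P // y ≠ x} → X * F' = (X + 1) * (ePoly (deleteLabel ω x) * b))
    (hF'' : IsEmpty {y : P // y ≠ x} → F' = b)
    (hP : Proper (ePoly (deleteLabel ω x)) (ePoly ω)) : Proper F' F := by
  refine Proper.of_mul (h := X) ?_ fun t ht h0 => ?_
  · rcases isEmpty_or_nonempty {y : P // y ≠ x} with he | hne
    · have : Unique P := ⟨⟨x⟩, fun y => by_contra fun hy => he.elim ⟨y, hy⟩⟩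
      obtain ⟨c, hc, hcω⟩ := ePoly_of_unique ω
      have e1 : X * F = (X * b) * (C c * (X + 1)) := by rw [hF, hcω]; ring
      have e2 : X * F' = (X * b) * 1 := by rw [hF'' he, mul_one]
      rw [e1, e2]
      refine Proper.mul _ ((Proper.C_mul_iff hc).mpr fun t ht => ?_)
      simpa using ht.le
    · rw [hF, hF' hne, mul_comm _ b, mul_comm _ b, ← mul_assoc, ← mul_assoc]
      exact hP.mul _
  · rw [aeval_X] at h0
    rw [h0] at ht
    exact lt_irrefl _ ht

theorem IsGlued.isDeletionProper_of_le [Finite P] [Finite Q] [Finite S] (h : IsGlued ω ν μ i j)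
    (hc : ∀ x y, i x < j y ∧ μ (i x) < μ (j y))
    (hω : IsDeletionProper ω) (hν : IsDeletionProper ν) : IsDeletionProper μ := by
  -- With an empty summand the label condition is vacuous, so the product formula of the other
  -- ordinal sum applies.
  rcases isEmpty_or_nonempty P with hP | hP
  · exact h.isDeletionProper_of_lt (fun x => isEmptyElim x) hω hν
  rcases isEmpty_or_nonempty Q with hQ | hQ
  · exact h.isDeletionProper_of_lt (fun _ y => isEmptyElim y) hω hν
  have e := X_mul_ePoly_of_combines_le (h.combines_le hc)
  refine ⟨fun t ht => ?_, fun s => ?_⟩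
  · have h0 : aeval t (X * ePoly μ) = 0 := by rw [map_mul, ht, mul_zero]
    rw [e, map_mul, mul_eq_zero] at h0
    rcases h0 with h0 | h0
    · have : t = -1 := by
        rw [map_add, aeval_X, map_one] at h0
        exact eq_neg_of_add_eq_zero_left h0
      simp [this]
    · exact hω.roots.mul hν.roots t h0
  obtain ⟨x | y, rfl⟩ := h.bij.2 s
  · obtain ⟨i', j', hi, hj, h'⟩ := h.delete x
    refine proper_of_X_mul_eq e (fun _ => X_mul_ePoly_of_combines_le (h'.combines_le
      fun a b => ?_)) (fun _ => ?_) (hω.proper x)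
    · have := hc a b
      rw [← hi, ← hj] at this
      exact this
    · rw [← one_mul (ePoly ν), ← ePoly_of_isEmpty (deleteLabel ω x)]
      exact ePoly_of_combines_lt (h'.combines_lt fun a => isEmptyElim a)
  · obtain ⟨j', i', hj, hi, h'⟩ := h.symm.delete y
    rw [mul_comm (ePoly ω)] at e
    refine proper_of_X_mul_eq e (fun _ => ?_) (fun _ => ?_) (hν.proper y)
    · rw [mul_comm (ePoly _)]
      refine X_mul_ePoly_of_combines_le (h'.symm.combines_le fun a b => ?_)
      have := hc a b
      rw [← hi, ← hj] at this
      exact this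
    · rw [← mul_one (ePoly ω), ← ePoly_of_isEmpty (deleteLabel ν y)]
      exact ePoly_of_combines_lt (h'.symm.combines_lt fun _ a => isEmptyElim a)

end Gluing

/-! ### Induction over series-parallel posets -/

theorem isGlued_of_orderIso_lex {P Q S : Type*} [PartialOrder P] [PartialOrder Q] [PartialOrder S]
    {ω : P ↪ ℕ} {ν : Q ↪ ℕ} {μ : S ↪ ℕ} (e : P ⊕ₗ Q ≃o S)
    (hl : ∀ x y : P, ω x < ω y → μ (e (Sum.inlₗ x)) < μ (e (Sum.inlₗ y)))
    (hr : ∀ x y : Q, ν x < ν y → μ (e (Sum.inrₗ x)) < μ (e (Sum.inrₗ y))) :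
    IsGlued ω ν μ (fun x => e (Sum.inlₗ x)) (fun y => e (Sum.inrₗ y)) := by
  refine ⟨?_, fun x y => by simp, fun x y => by simp, label_lt_iff_of_imp hl,
    label_lt_iff_of_imp hr⟩
  have : Sum.elim (fun x => e (Sum.inlₗ x)) (fun y => e (Sum.inrₗ y)) =
      e ∘ (toLex : P ⊕ Q → P ⊕ₗ Q) := by
    ext (x | x) <;> rfl
  rw [this]
  exact e.bijective.comp toLex.bijective

/-- Finiteness is part of the conclusion of the induction because it descends from S to its
summands. -/
theorem IsSeriesParallel.isDeletionProper {S : Type u} [PartialOrder S] {μ : S ↪ ℕ}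
    (hμ : IsSeriesParallel μ) : Finite S → IsDeletionProper μ := by
  induction hμ with
  | empty μ =>
    refine fun _ => ⟨fun t ht => ?_, fun x => isEmptyElim x⟩
    rw [ePoly_of_isEmpty, map_one] at ht
    exact absurd ht one_ne_zero
  | singleton μ =>
    obtain ⟨c, hc, e⟩ := ePoly_of_unique μ
    refine fun _ => ⟨fun t ht => ?_, fun x => ?_⟩
    · have : t = 0 := by simpa [e, hc.ne'] using ht
      simp [this]
    · have : IsEmpty {y // y ≠ x} := ⟨fun y => y.2 (Subsingleton.elim _ _)⟩
      rw [e, ePoly_of_isEmpty, Proper.C_mul_iff hc]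
      intro t ht
      simpa using ht.le
  | @ordinalSum₀ P Q S _ _ _ ω ν μ _ _ e h hP hQ =>
    intro hS
    have : Finite (P ⊕ Q) := Finite.of_equiv S e.toEquiv.symm
    have : Finite P := Finite.of_injective (Sum.inl : P → P ⊕ Q) Sum.inl_injective
    have : Finite Q := Finite.of_injective (Sum.inr : Q → P ⊕ Q) Sum.inr_injective
    exact (isGlued_of_orderIso_lex e h.left h.right).isDeletionProper_of_le
      (fun x y => ⟨by simp, h.cross x y⟩) (hP inferInstance) (hQ inferInstance)
  | @ordinalSum₁ P Q S _ _ _ ω ν μ _ _ e h hP hQ =>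
    intro hS
    have : Finite (P ⊕ Q) := Finite.of_equiv S e.toEquiv.symm
    have : Finite P := Finite.of_injective (Sum.inl : P → P ⊕ Q) Sum.inl_injective
    have : Finite Q := Finite.of_injective (Sum.inr : Q → P ⊕ Q) Sum.inr_injective
    exact (isGlued_of_orderIso_lex e h.left h.right).isDeletionProper_of_lt
      (fun x y => ⟨by simp, h.cross y x⟩) (hP inferInstance) (hQ inferInstance)
  | @disjointUnion P Q S _ _ _ ω ν μ _ _ e h hP hQ =>
    intro hS
    have : Finite (P ⊕ Q) := Finite.of_equiv S e.toEquiv.symm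
    have : Finite P := Finite.of_injective (Sum.inl : P → P ⊕ Q) Sum.inl_injective
    have : Finite Q := Finite.of_injective (Sum.inr : Q → P ⊕ Q) Sum.inr_injective
    have hg : IsGlued ω ν μ (fun x => e (Sum.inl x)) (fun y => e (Sum.inr y)) := by
      refine ⟨?_, fun x y => by simp, fun x y => by simp, label_lt_iff_of_imp h.left,
        label_lt_iff_of_imp h.right⟩
      have : Sum.elim (fun x => e (Sum.inl x)) (fun y => e (Sum.inr y)) = e := by
        ext (x | x) <;> rfl
      rw [this]
      exact e.bijective
    exact hg.isDeletionProper_of_true (fun x y => by simp) (hP inferInstance) (hQ inferInstance)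

end LabelledPoset

theorem mainTheorem5 {S : Type*} [PartialOrder S] [Finite S] (μ : S ↪ ℕ)
    (hμ : LabelledPoset.IsSeriesParallel μ) (x : S) :
    LabelledPoset.Interlaces (LabelledPoset.ePoly (LabelledPoset.deleteLabel μ x))
      (LabelledPoset.ePoly μ) :=
  have h := hμ.isDeletionProper inferInstance
  (h.proper x).interlaces (LabelledPoset.ePoly_ne_zero _)
    (LabelledPoset.ePoly_ne_zero _) h.roots.splits
    (LabelledPoset.natDegree_ePoly_deleteLabel μ x)
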